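/- Let $p\ge 5$ be a prime, and let $\ell_0,\ell_1$ be primes with $\ell_0\equiv 1 \pmod p$ and $\ell_1\not\equiv 0,\pm1 \pmod p$, such that $\ell_1$ is a $p$th power modulo $\ell_0$. Put $N=\ell_0\ell_1$, let $\omega$ be the mod $p$ cyclotomic character of $G_{\mathbb Q}=\mathrm{Gal}(\overline{\mathbb Q}/\mathbb Q)$, and let $\mathbb F_p(i)$ be $\mathbb F_p$ with action by $\omega^i$. Cochains are continuous cochains on the Galois group of the maximal extension of $\mathbb Q$ unramified outside $Np\infty$; $d$ is the usual differential and $\smile$ the usual cup product. For $q\in\{\ell_0,\ell_1,p\}$ fix an embedding $\overline{\mathbb Q}\hookrightarrow\overline{\mathbb Q}_q$, with decomposition group $G_q$ and inertia group $I_q$ in $G_{\mathbb Q}$; fix also a primitive $p$th root of unity $\zeta$ (so that $\mu_p\cong\mathbb F_p(1)$) and $p$th roots $\ell_0^{1/p},\ell_1^{1/p}\in\overline{\mathbb Q}$, the latter in $\mathbb Q_p$ if possible. Let $b_0$ and $b$ be the Kummer cocycles with values in $\mathbb F_p(1)$ given by $\ell_0^{1/p}$ and $\ell_1^{1/p}$,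 and let $\gamma_0\in I_{\ell_0}$ satisfy $b_0(\gamma_0)=1$. Let $c$ be the $1$-cocycle with values in $\mathbb F_p(-1)$ whose class is ramified exactly at $\ell_0$ and restricts to $0$ on $G_p$, with $c(\gamma_0)=1$ and $c|_{G_{\ell_1}}=0$; let $x_c\in\mathbb F_p(-1)$ satisfy $c|_{G_p}=dx_c$. Let $a$ be a $1$-cochain with values in $\mathbb F_p$ such that $-da=b\smile c$, $(a-b\smile x_c)|_{I_p}=0$, and $a|_{G_{\ell_0}}=\alpha\smile c|_{G_{\ell_0}}$ for some $\alpha\in\mathbb F_p(1)$. Put $d^{(1)}=bc-a$. Let $M'$ be the fixed field of the kernel of $$\upsilon=\begin{pmatrix}\omega&b&\omega a\\0&1&\omega c\\0&0&\omega\end{pmatrix}.$$ If the equation $-db_2=a\smile b+b\smile d^{(1)}$ has a solution $b_2$ among the $1$-cochains with values in $\mathbb F_p(1)$, take a solution such that (a) $b_2|_{G_{\ell_0}}=\beta\smile c|_{G_{\ell_0}}$ for some $\beta\in\mathbb F_p(2)$, and (b) there are $1$-cochains $a_2$, $c_2$ with values in $\mathbb F_p$, $\mathbb F_p(-1)$ such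 that $-da_2=a\smile a+b\smile c_2+b_2\smile c$ and $-dc_2=c\smile a+d^{(1)}\smile c$, and such that, with $d_2=bc_2+b_2c-ad^{(1)}-a_2$, the representation $$\rho_2=\begin{pmatrix}\omega(1+a\epsilon+a_2\epsilon^2)&b+b_2\epsilon\\ \omega(c+c_2\epsilon)&1+d^{(1)}\epsilon+d_2\epsilon^2\end{pmatrix}$$ is finite-flat at $p$. Here $\rho_2$ takes values in the ring $E_2=\begin{pmatrix}R&R/\epsilon^2\\R/\epsilon^2&R\end{pmatrix}$, $R=\mathbb F_p[\epsilon]/(\epsilon^3)$, in which products of two off-diagonal entries are multiplied by $\epsilon$, and finite-flat at $p$ means that $E_2$, on which $G_p$ acts through $\rho_2$ by left multiplication, is the Galois module of $\overline{\mathbb Q}_p$-points of a finite flat group scheme over $\mathbb Z_p$. Let $M''$ be the fixed field of the kernel of $$\nu=\begin{pmatrix}\omega&b&\omega a&b_2\\0&1&\omega c&d^{(1)}\\0&0&\omega&b\\0&0&0&1\end{pmatrix}.$$ If the equation for $b_2$ has no solution, let $M''=M'$. Let $D_{\ell_0}\subset\mathrm{Gal}(M''/\mathbb Q)$ be the decomposition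 group of any prime of $M''$ over $\ell_0$, and let $n_{\ell_0}$ be the order of its normalizer in $\mathrm{Gal}(M''/\mathbb Q)$. 1. If $M''=M'$, then $n_{\ell_0}=p^2(p-1)$. 2. If $[M'':M']=p$, then $n_{\ell_0}$ is either $2p^3$ or $p^3(p-1)$. Moreover, $n_{\ell_0}=2p^3$ if and only if the conjugacy class of the subgroup $D_{\ell_0}$ of $\mathrm{Gal}(M''/\mathbb Q)$ has cardinality $p(p-1)/2$, and $n_{\ell_0}=p^3(p-1)$ if and only if this conjugacy class has cardinality $p$. -/

import Mathlib

open scoped NumberField Pointwise Matrix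

noncomputable section

/-- The field of algebraic numbers. -/
abbrev Qbar : Type := AlgebraicClosure ℚ

/-- The absolute Galois group of `ℚ`. -/
abbrev GQ : Type := Gal(Qbar/ℚ)

/-- The ring of algebraic integers. A choice of an embedding of `Qbar` into an algebraic closure of
`ℚ_q` enters the constructions below only through the prime ideal `𝔮` of `Zbar` over `q` that it
induces: the decomposition group `G_q` is the stabilizer of `𝔮`, and the inertia group `I_q` is
the inertia group of `𝔮`. -/
abbrev Zbar : Type := 𝓞 Qbar

/-- The decomposition group of a prime of `Zbar`. -/
def decompGroup (P : Ideal Zbar) : Subgroup GQ := MulAction.stabilizer GQ P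

/-- The inertia group of a prime of `Zbar`. -/
def inertiaGroup (P : Ideal Zbar) : Subgroup GQ := Ideal.inertia GQ P

/-- The subgroup generated by the inertia groups at all finite primes not dividing `m`. Its closure
is the kernel of the projection from `GQ` to the Galois group of the maximal extension of `ℚ` that
is unramified outside `m` and infinity. -/
def ramificationOutside (m : ℕ) : Subgroup GQ :=
  ⨆ P : {P : Ideal Zbar // P.IsMaximal ∧ (m : Zbar) ∉ P}, inertiaGroup P.1

/-- Continuous `1`-cochains, with values in (any twist of) `ℤ/p`, on the Galois group of the maximal
extension of `ℚ` unramified outside `m` and infinity, viewed as functions on `GQ`. -/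
def IsCochain (m : ℕ) {p : ℕ} (f : GQ → ZMod p) : Prop :=
  Continuous f ∧ ∀ σ : GQ, ∀ τ ∈ ramificationOutside m, f (σ * τ) = f σ

section Cochains

variable {p : ℕ} [Fact p.Prime]

/-- The mod `p` cyclotomic character. -/
def omega (p : ℕ) [Fact p.Prime] : GQ →* (ZMod p)ˣ :=
  (modularCyclotomicCharacter Qbar (n := p)
    (HasEnoughRootsOfUnity.natCard_rootsOfUnity Qbar p)).comp (MulSemiringAction.toRingAut GQ Qbar)

/-- The action of `σ` on `𝔽_p(i)`: multiplication by `ω(σ)^i`. -/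
def tw (i : ℤ) (σ : GQ) : ZMod p := ((omega p σ ^ i : (ZMod p)ˣ) : ZMod p)

/-- The differential of a `0`-cochain with values in `𝔽_p(i)`. -/
def d0 (i : ℤ) (x : ZMod p) (σ : GQ) : ZMod p := tw i σ * x - x

/-- The differential of a `1`-cochain with values in `𝔽_p(i)`. -/
def d1 (i : ℤ) (f : GQ → ZMod p) (σ τ : GQ) : ZMod p := tw i σ * f τ - f (σ * τ) + f σ

/-- The cup product of a `1`-cochain with a `1`-cochain with values in `𝔽_p(j)`. -/
def cup (j : ℤ) (f g : GQ → ZMod p) (σ τ : GQ) : ZMod p := f σ * (tw j σ * g τ)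

/-- The cup product of a `1`-cochain with a `0`-cochain with values in `𝔽_p(j)`. -/
def cup0 (j : ℤ) (f : GQ → ZMod p) (x : ZMod p) (σ : GQ) : ZMod p := f σ * (tw j σ * x)

/-- The class of a cocycle with values in `𝔽_p(i)` is unramified at `P`. -/
def ClassUnramifiedAt (i : ℤ) (f : GQ → ZMod p) (P : Ideal Zbar) : Prop :=
  ∃ x : ZMod p, ∀ σ ∈ inertiaGroup P, f σ = d0 i x σ

/-- The class of a cocycle with values in `𝔽_p(i)` is split at `P`. -/
def ClassSplitAt (i : ℤ) (f : GQ → ZMod p) (P : Ideal Zbar) : Prop :=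
  ∃ x : ZMod p, ∀ σ ∈ decompGroup P, f σ = d0 i x σ

/-- The subfield of `Qbar` cut out by a matrix representation `ρ` of `GQ`, that is, the fixed field
of its kernel. -/
def cutOut {n : Type} [Fintype n] [DecidableEq n] (ρ : GQ → Matrix n n (ZMod p)) :
    IntermediateField ℚ Qbar :=
  IntermediateField.fixedField (Subgroup.closure {σ : GQ | ρ σ = 1})

/-- The representation `ρ` is finite-flat at `p`, at the decomposition group of the prime `P`
over `p`: there is a finite flat group scheme over `ℤ_p` (the spectrum of a finite flat commutative
Hopf algebra `H`) whose group of points over the algebraic closure of `ℚ_p` is isomorphic, as a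
Galois module, to the restriction of `ρ`. The Galois group of `ℚ_p` is mapped to `GQ` through an
embedding `ι` that induces `P`. -/
def IsFiniteFlatAt (P : Ideal Zbar) {n : Type} [Fintype n]
    (ρ : GQ → Matrix n n (ZMod p)) : Prop :=
  ∃ ι : Qbar →ₐ[ℚ] PadicAlgCl p, (∀ x : Zbar, x ∈ P ↔ ‖ι (x : Qbar)‖ < 1) ∧
  ∃ (H : Type) (_ : CommRing H) (_ : HopfAlgebra ℤ_[p] H)
    (_ : Module.Finite ℤ_[p] H) (_ : Module.Flat ℤ_[p] H)
    (e : (H →ₐ[ℤ_[p]] PadicAlgCl p) ≃ (n → ZMod p)),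
    (∀ x y, e ((Algebra.TensorProduct.productMap x y).comp (Bialgebra.comulAlgHom ℤ_[p] H))
        = e x + e y) ∧
    ∀ (s : PadicAlgCl p ≃ₐ[ℚ_[p]] PadicAlgCl p) (τ : GQ),
      (∀ z : Qbar, ι (τ z) = s (ι z)) →
      ∀ x, e (((s : PadicAlgCl p →ₐ[ℚ_[p]] PadicAlgCl p).restrictScalars ℤ_[p]).comp x)
        = ρ τ *ᵥ e x

end Cochains

/-- Pinning data: a prime of `Zbar` over each of `ℓ₀`, `ℓ₁`, `p` (see `Zbar`), a primitive `p`-th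
root of unity, and `p`-th roots of `ℓ₀` and of `ℓ₁`, the latter in `ℚ_p` if possible. (An algebraic
number lies in `ℚ_p` if and only if the decomposition group at `p` fixes it.) -/
structure PinningData (p ℓ₀ ℓ₁ : ℕ) where
  P₀ : Ideal Zbar
  P₁ : Ideal Zbar
  Pp : Ideal Zbar
  isPrime₀ : P₀.IsPrime
  isPrime₁ : P₁.IsPrime
  isPrimep : Pp.IsPrime
  mem₀ : (ℓ₀ : Zbar) ∈ P₀
  mem₁ : (ℓ₁ : Zbar) ∈ P₁
  memp : (p : Zbar) ∈ Pp
  ζ : Qbar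
  isPrimitiveRoot : IsPrimitiveRoot ζ p
  root₀ : Qbar
  root₁ : Qbar
  root₀_pow : root₀ ^ p = ℓ₀
  root₁_pow : root₁ ^ p = ℓ₁
  root₁_local : (∃ r : Qbar, r ^ p = ℓ₁ ∧ ∀ σ ∈ decompGroup Pp, σ r = r) →
    ∀ σ ∈ decompGroup Pp, σ root₁ = root₁

/-- `b` is the Kummer cocycle `σ ↦ σ(r)/r`, where `μ_p` is identified with `𝔽_p(1)` by means
of `ζ`. -/
def IsKummerCocycle {p : ℕ} (ζ r : Qbar) (b : GQ → ZMod p) : Prop :=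
  ∀ σ : GQ, σ r = ζ ^ (b σ).val * r

/-- The pinned cocycles: the Kummer cocycles `b₀`, `b` of `ℓ₀`, `ℓ₁`, and the cocycle `c` with
values in `𝔽_p(-1)` whose class is ramified exactly at `ℓ₀` and split at `p`, which vanishes on the
decomposition group at `ℓ₁`, and which is normalized by `c(γ₀) = 1` at an element `γ₀` of the
inertia group at `ℓ₀` with `b₀(γ₀) = 1`. -/
structure PinnedCocycles {p ℓ₀ ℓ₁ : ℕ} [Fact p.Prime] (D : PinningData p ℓ₀ ℓ₁) where
  b₀ : GQ → ZMod p
  b : GQ → ZMod p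
  c : GQ → ZMod p
  γ₀ : GQ
  kummer₀ : IsKummerCocycle D.ζ D.root₀ b₀
  kummer₁ : IsKummerCocycle D.ζ D.root₁ b
  γ₀_mem : γ₀ ∈ inertiaGroup D.P₀
  b₀_γ₀ : b₀ γ₀ = 1
  c_cochain : IsCochain (ℓ₀ * ℓ₁ * p) c
  c_cocycle : ∀ σ τ, d1 (-1) c σ τ = 0
  c_ramified : ¬ ClassUnramifiedAt (-1) c D.P₀
  c_unramified_l1 : ClassUnramifiedAt (-1) c D.P₁
  c_unramified_p : ClassUnramifiedAt (-1) c D.Pp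
  c_split_p : ClassSplitAt (-1) c D.Pp
  c_γ₀ : c γ₀ = 1
  c_l1 : ∀ σ ∈ decompGroup D.P₁, c σ = 0

section Fields

variable {p ℓ₀ ℓ₁ : ℕ} [Fact p.Prime] {D : PinningData p ℓ₀ ℓ₁}

/-- `a` is the solution of `-da = b ⌣ c` with the prescribed local conditions at `p` and at `ℓ₀`. -/
structure IsA1 (C : PinnedCocycles D) (a : GQ → ZMod p) : Prop where
  cochain : IsCochain (ℓ₀ * ℓ₁ * p) a
  eqn : ∀ σ τ, -d1 0 a σ τ = cup (-1) C.b C.c σ τ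
  local_p : ∃ x : ZMod p, (∀ σ ∈ decompGroup D.Pp, C.c σ = d0 (-1) x σ) ∧
    ∀ σ ∈ inertiaGroup D.Pp, a σ - cup0 (-1) C.b x σ = 0
  local_l0 : ∃ α : ZMod p, ∀ σ ∈ decompGroup D.P₀, a σ = α * C.c σ

/-- The cochain `d = bc - a`. -/
def dCochain (C : PinnedCocycles D) (a : GQ → ZMod p) (σ : GQ) : ZMod p := C.b σ * C.c σ - a σ

/-- `y` is a cochain with `-dy = a ⌣ b + b ⌣ d`. -/
def SolvesB2 (C : PinnedCocycles D) (a y : GQ → ZMod p) : Prop :=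
  IsCochain (ℓ₀ * ℓ₁ * p) y ∧
  ∀ σ τ, -d1 1 y σ τ = cup 1 a C.b σ τ + cup 0 C.b (dCochain C a) σ τ

/-- The first column of the generalized matrix algebra
`E₂ = [R, R/ε²; R/ε², R]`, `R = 𝔽_p[ε]/ε³`, in which the product of two off-diagonal entries is
multiplied by `ε`, is a left module over `E₂` with basis `(1, ε, ε²; 1, ε)`. This is the matrix of
the action of `ρ₂ = [ω(1 + aε + a₂ε²), b + b₂ε; ω(c + c₂ε), 1 + dε + d₂ε²]` on it. -/
def rho2Col1 (C : PinnedCocycles D) (a b₂ a₂ c₂ : GQ → ZMod p) (σ : GQ) :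
    Matrix (Fin 5) (Fin 5) (ZMod p) :=
  let w : ZMod p := tw 1 σ
  !![w, 0, 0, 0, 0;
     w * a σ, w, 0, C.b σ, 0;
     w * a₂ σ, w * a σ, w, b₂ σ, C.b σ;
     w * C.c σ, 0, 0, 1, 0;
     w * c₂ σ, w * C.c σ, 0, dCochain C a σ, 1]

/-- The matrix of the action of `ρ₂` on the second column of `E₂`, with basis `(1, ε; 1, ε, ε²)`.
Here `d₂ = b c₂ + b₂ c - a d - a₂`, by which `ρ₂` has determinant `ω`. -/
def rho2Col2 (C : PinnedCocycles D) (a b₂ a₂ c₂ : GQ → ZMod p) (σ : GQ) :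
    Matrix (Fin 5) (Fin 5) (ZMod p) :=
  let w : ZMod p := tw 1 σ
  let d := dCochain C a σ
  let d₂ := C.b σ * c₂ σ + b₂ σ * C.c σ - a σ * d - a₂ σ
  !![w, 0, C.b σ, 0, 0;
     w * a σ, w, b₂ σ, C.b σ, 0;
     0, 0, 1, 0, 0;
     w * C.c σ, 0, d, 1, 0;
     w * c₂ σ, w * C.c σ, d₂, d, 1]

/-- There is a deformation `ρ₂` that is finite-flat at `p` and has `b₂` as its coordinate. A
representation with values in `E₂` is finite-flat when `E₂` is, as a left module; `E₂` is the direct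
sum of its two columns. -/
def HasFlatRho2 (C : PinnedCocycles D) (a b₂ : GQ → ZMod p) : Prop :=
  ∃ a₂ c₂ : GQ → ZMod p, IsCochain (ℓ₀ * ℓ₁ * p) a₂ ∧ IsCochain (ℓ₀ * ℓ₁ * p) c₂ ∧
    (∀ σ τ, -d1 0 a₂ σ τ = cup 0 a a σ τ + cup (-1) C.b c₂ σ τ + cup (-1) b₂ C.c σ τ) ∧
    (∀ σ τ, -d1 (-1) c₂ σ τ = cup 0 C.c a σ τ + cup (-1) (dCochain C a) C.c σ τ) ∧
    IsFiniteFlatAt D.Pp (rho2Col1 C a b₂ a₂ c₂) ∧ IsFiniteFlatAt D.Pp (rho2Col2 C a b₂ a₂ c₂)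

/-- `b₂` is a solution of `-db₂ = a ⌣ b + b ⌣ d` with the prescribed local conditions at `ℓ₀` and
at `p`. -/
structure IsB2 (C : PinnedCocycles D) (a b₂ : GQ → ZMod p) : Prop where
  solves : SolvesB2 C a b₂
  local_l0 : ∃ β : ZMod p, ∀ σ ∈ decompGroup D.P₀, b₂ σ = β * C.c σ
  local_p : HasFlatRho2 C a b₂

/-- The `3`-dimensional representation that cuts out `M'`. -/
def upsilon (C : PinnedCocycles D) (a : GQ → ZMod p) (σ : GQ) : Matrix (Fin 3) (Fin 3) (ZMod p) :=
  let w : ZMod p := tw 1 σ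
  !![w, C.b σ, w * a σ;
     0, 1, w * C.c σ;
     0, 0, w]

/-- The `4`-dimensional representation that cuts out `M''`. -/
def nuRep (C : PinnedCocycles D) (a b₂ : GQ → ZMod p) (σ : GQ) :
    Matrix (Fin 4) (Fin 4) (ZMod p) :=
  let w : ZMod p := tw 1 σ
  !![w, C.b σ, w * a σ, b₂ σ;
     0, 1, w * C.c σ, dCochain C a σ;
     0, 0, w, C.b σ;
     0, 0, 0, 1]

/-- The field `M'`. -/
def fieldM' (C : PinnedCocycles D) (a : GQ → ZMod p) : IntermediateField ℚ Qbar :=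
  cutOut (upsilon C a)

/-- `M` is the field `M''`: the field cut out by `nuRep`, for a solution `b₂` with the prescribed
local conditions, if the differential equation for `b₂` is soluble, and `M'` if it is not. -/
def IsFieldM'' (C : PinnedCocycles D) (a : GQ → ZMod p) (M : IntermediateField ℚ Qbar) : Prop :=
  (∃ b₂, IsB2 C a b₂ ∧ M = cutOut (nuRep C a b₂)) ∨
  ((¬ ∃ y, SolvesB2 C a y) ∧ M = fieldM' C a)

end Fields

/-- The decomposition group in `Gal(M/ℚ)` of a prime of the ring of integers of `M`. -/
def decompSubgroup {M : IntermediateField ℚ Qbar} (P : Ideal (𝓞 M)) : Subgroup Gal(M/ℚ) :=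
  MulAction.stabilizer Gal(M/ℚ) P

/-- The order of the normalizer of a subgroup. -/
def normalizerOrder {G : Type*} [Group G] (H : Subgroup G) : ℕ :=
  Nat.card (Subgroup.normalizer (H : Set G))

/-- The number of conjugates of a subgroup. -/
def conjClassSize {G : Type*} [Group G] (H : Subgroup G) : ℕ :=
  Nat.card (MulAction.orbit (ConjAct G) H)

end

/-! Everything is computed in coordinates. The cochain equations say that `upsilon` and `nuRep` are
homomorphisms, so an element of the Galois group is determined by its values $(\omega,b,c,a)$,
together with $b_2$ at the second level. All tuples with $\omega\ne0$ occur: Kummer theory gives $s$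
with $\omega(s)=1$, $b(s)\ne0$, inertia at $\ell_0$ gives $\gamma_0$, and commutators of these reach
$a$ and then $b_2$. Hence $\mathrm{Gal}(M''/\mathbb Q)$ has order $p^4(p-1)$ when $b_2$ exists.

Since $\ell_0\equiv1$ and $\ell_1$ is a $p$th power modulo $\ell_0$, both $\omega-1$ and $b$ vanish
on $G_{\ell_0}$, where also $a=\alpha c$ and $b_2=\beta c$. As $c(\gamma_0)=1$, the decomposition
group is the whole line $(1,0,x,\alpha x,\beta x)$. Conjugating by $\sigma$ shows that $\sigma$
normalizes this line if and only if $b=\alpha(1-\omega)$ and, at the second level,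
$(\omega^2-1)(\alpha^2+\beta)=0$ (`mem_normalizer_iff₃`, `mem_normalizer_iff₄`). The other
coordinates are free, so the normalizer has order $p^2(p-1)$ for $M'$. For $M''\ne M'$ it has order
$p^3(p-1)$ or $2p^3$, according as $\alpha^2+\beta$ vanishes or not. Orbit-stabilizer gives the
class sizes. -/

instance : IsAlgClosure ℚ Qbar := by
  -- Two `ℚ`-algebra structures on `Qbar` are in play; such a structure is unique.
  have h : AlgebraicClosure.instAlgebra ℚ = (DivisionRing.toRatAlgebra : Algebra ℚ Qbar) :=
    Subsingleton.elim _ _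
  exact h ▸ AlgebraicClosure.instIsAlgClosure ℚ

instance : Algebra.IsAlgebraic ℚ Qbar := IsAlgClosure.isAlgebraic

instance : IsGalois ℚ Qbar := IsAlgClosure.isGalois ℚ Qbar

/-! ### Galois action on the primes of the ring of algebraic integers -/

section Transitivity

variable {F A : Type} [Field F] [Algebra F Qbar] [IsGalois F Qbar] [CommRing A]
  [Algebra A F] [IsIntegralClosure A ℤ F] [Algebra A Zbar] [Algebra A Qbar]
  [IsScalarTower A F Qbar] [IsScalarTower A Zbar Qbar]

omit [IsGalois F Qbar] [IsIntegralClosure A ℤ F] in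
theorem smulCommClass_ringOfIntegers : SMulCommClass Gal(Qbar/F) A Zbar := by
  refine ⟨fun g x y ↦ NumberField.RingOfIntegers.ext ?_⟩
  rw [Algebra.smul_def, Algebra.smul_def]
  have hx : g (algebraMap Zbar Qbar (algebraMap A Zbar x)) =
      algebraMap Zbar Qbar (algebraMap A Zbar x) := by
    rw [← IsScalarTower.algebraMap_apply A Zbar Qbar, IsScalarTower.algebraMap_apply A F Qbar,
      g.commutes]
  have coe_smul (z : Zbar) : ((g • z : Zbar) : Qbar) = g (algebraMap Zbar Qbar z) := rfl
  rw [coe_smul, map_mul, map_mul, hx]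
  exact (map_mul (algebraMap Zbar Qbar) (algebraMap A Zbar x) (g • y)).symm

omit [CommRing A] [Algebra A F] [IsIntegralClosure A ℤ F] [Algebra A Zbar] [Algebra A Qbar]
  [IsScalarTower A F Qbar] [IsScalarTower A Zbar Qbar] in
theorem continuousSMul_ringOfIntegers [TopologicalSpace Zbar] [DiscreteTopology Zbar] :
    ContinuousSMul Gal(Qbar/F) Zbar := by
  rw [continuousSMul_iff_stabilizer_isOpen]
  intro x
  have : (MulAction.stabilizer Gal(Qbar/F) x : Set Gal(Qbar/F)) =
      MulAction.stabilizer Gal(Qbar/F) (x : Qbar) := by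
    ext g
    exact NumberField.RingOfIntegers.ext_iff
  rw [this]
  exact stabilizer_isOpen_of_isIntegral (x : Qbar)

theorem isInvariant_ringOfIntegers : Algebra.IsInvariant A Zbar Gal(Qbar/F) := by
  refine ⟨fun x hx ↦ ?_⟩
  obtain ⟨y, hy⟩ := (InfiniteGalois.mem_range_algebraMap_iff_fixed (k := F) (x : Qbar)).2
    fun g ↦ congrArg (algebraMap Zbar Qbar) (hx g)
  have hyi : IsIntegral ℤ y := by
    rw [← isIntegral_algebraMap_iff (FaithfulSMul.algebraMap_injective F Qbar), hy]
    exact x.2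
  obtain ⟨z, hz⟩ := (IsIntegralClosure.isIntegral_iff (A := A)).1 hyi
  refine ⟨z, NumberField.RingOfIntegers.ext ?_⟩
  change algebraMap Zbar Qbar _ = _
  rw [← IsScalarTower.algebraMap_apply A Zbar Qbar, IsScalarTower.algebraMap_apply A F Qbar, hz, hy]

/-- A profinite group acting continuously on a discrete ring permutes transitively the primes over a
given prime of the invariants. Both $F=\mathbb Q$ and $F=M$ are needed later. -/
theorem exists_smul_eq_of_comap_eq (P Q : Ideal Zbar) [P.IsPrime] [Q.IsPrime]
    (h : P.comap (algebraMap A Zbar) = Q.comap (algebraMap A Zbar)) :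
    ∃ g : Gal(Qbar/F), Q = g • P := by
  let _ : TopologicalSpace Zbar := ⊥
  have : DiscreteTopology Zbar := ⟨rfl⟩
  have := smulCommClass_ringOfIntegers (F := F) (A := A)
  have := continuousSMul_ringOfIntegers (F := F)
  have := isInvariant_ringOfIntegers (F := F) (A := A)
  exact Algebra.IsInvariant.exists_smul_of_under_eq_of_profinite (A := A) P Q h

end Transitivity

theorem exists_smul_eq_of_natCast_mem {ℓ : ℕ} (hℓ : ℓ.Prime) (P Q : Ideal Zbar) [P.IsPrime]
    [Q.IsPrime] (hP : (ℓ : Zbar) ∈ P) (hQ : (ℓ : Zbar) ∈ Q) : ∃ g : GQ, Q = g • P := by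
  have key : ∀ R : Ideal Zbar, R.IsPrime → (ℓ : Zbar) ∈ R →
      R.comap (algebraMap ℤ Zbar) = Ideal.span {(ℓ : ℤ)} := by
    intro R hR hℓR
    have hmax : (Ideal.span {(ℓ : ℤ)}).IsMaximal :=
      PrincipalIdealRing.isMaximal_of_irreducible (Nat.prime_iff_prime_int.1 hℓ).irreducible
    refine (hmax.eq_of_le (hR.comap _).ne_top ?_).symm
    rw [Ideal.span_singleton_le_iff_mem, Ideal.mem_comap]
    simpa using hℓR
  exact exists_smul_eq_of_comap_eq (F := ℚ) (A := ℤ) P Q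
    ((key P ‹_› hP).trans (key Q ‹_› hQ).symm)

/-! ### Decomposition groups in a normal subfield -/

section Field

variable (M : IntermediateField ℚ Qbar)

instance : IsIntegralClosure (𝓞 M) ℤ M := integralClosure.isIntegralClosure ℤ M

/-- The contraction of a prime of `Zbar` to a subfield. -/
noncomputable abbrev contraction (Q : Ideal Zbar) : Ideal (𝓞 M) := Q.comap (algebraMap (𝓞 M) Zbar)

theorem smul_contraction [Normal ℚ M] (σ : GQ) (Q : Ideal Zbar) :
    AlgEquiv.restrictNormalHom M σ • contraction M Q = contraction M (σ • Q) := by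
  ext x
  rw [Ideal.mem_pointwise_smul_iff_inv_smul_mem, Ideal.mem_comap, Ideal.mem_comap,
    Ideal.mem_pointwise_smul_iff_inv_smul_mem]
  suffices algebraMap (𝓞 M) Zbar ((AlgEquiv.restrictNormalHom M σ)⁻¹ • x) =
      σ⁻¹ • algebraMap (𝓞 M) Zbar x by rw [this]
  rw [← map_inv]
  apply NumberField.RingOfIntegers.ext
  exact AlgEquiv.restrictNormal_commutes σ⁻¹ M (x : M)

/-- A lift $\sigma$ of an element stabilizing the contraction may move $Q$, but only to a prime with
the same contraction. An element of $\mathrm{Gal}(\overline{\mathbb Q}/M)$ moves it back without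
changing the restriction to $M$. -/
theorem decompSubgroup_contraction [Normal ℚ M] (Q : Ideal Zbar) [Q.IsPrime] :
    decompSubgroup (contraction M Q) = (decompGroup Q).map (AlgEquiv.restrictNormalHom M) := by
  ext s
  constructor
  · intro hs
    obtain ⟨σ, rfl⟩ := AlgEquiv.restrictNormalHom_surjective Qbar s
    have h : contraction M (σ • Q) = contraction M Q := (smul_contraction M σ Q).symm.trans hs
    have : IsGalois M Qbar := IsGalois.tower_top_of_isGalois ℚ M Qbar
    obtain ⟨g, hg⟩ := exists_smul_eq_of_comap_eq (F := M) (A := 𝓞 M) (σ • Q) Q h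
    refine ⟨g.restrictScalars ℚ * σ, ?_, ?_⟩
    · change (g.restrictScalars ℚ * σ) • Q = Q
      rw [mul_smul]
      exact hg.symm
    · rw [map_mul, mul_eq_right]
      ext x
      exact (AlgEquiv.restrictNormal_commutes (g.restrictScalars ℚ) M x).trans (g.commutes x)
  · rintro ⟨σ, hσ, rfl⟩
    change AlgEquiv.restrictNormalHom M σ • contraction M Q = contraction M Q
    rw [smul_contraction, show σ • Q = Q from hσ]

theorem exists_eq_contraction_smul {ℓ : ℕ} (hℓ : ℓ.Prime) (Q : Ideal Zbar) [Q.IsPrime]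
    (hQ : (ℓ : Zbar) ∈ Q) (P : Ideal (𝓞 M)) [P.IsPrime] (hP : (ℓ : 𝓞 M) ∈ P) :
    ∃ σ : GQ, P = contraction M (σ • Q) := by
  have hinj : RingHom.ker (algebraMap (𝓞 M) Zbar) ≤ P := by
    rw [(RingHom.injective_iff_ker_eq_bot _).1 (FaithfulSMul.algebraMap_injective (𝓞 M) Zbar)]
    exact bot_le
  obtain ⟨R, hR, hRP⟩ := Ideal.exists_ideal_over_prime_of_isIntegral_of_isDomain P hinj
  have hℓR : (ℓ : Zbar) ∈ R := by
    have : (ℓ : 𝓞 M) ∈ R.comap (algebraMap (𝓞 M) Zbar) := hRP ▸ hP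
    simpa using this
  obtain ⟨σ, hσ⟩ := exists_smul_eq_of_natCast_mem hℓ Q R hQ hℓR
  exact ⟨σ, by rw [← hσ]; exact hRP.symm⟩

end Field

theorem normalizerOrder_smul {G : Type*} [Group G] (g : G) (H : Subgroup G) :
    normalizerOrder (H.map (MulAut.conj g).toMonoidHom) = normalizerOrder H := by
  rw [normalizerOrder, ← Subgroup.map_equiv_normalizer_eq]
  exact (Nat.card_congr ((Subgroup.normalizer (H : Set G)).equivMapOfInjective _
    (MulAut.conj g).injective).toEquiv).symm

theorem conjClassSize_mul_normalizerOrder {G : Type*} [Group G] (H : Subgroup G) :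
    conjClassSize H * normalizerOrder H = Nat.card G := by
  have e : MulAction.stabilizer (ConjAct G) H ≃ Subgroup.normalizer (H : Set G) :=
    ConjAct.ofConjAct.toEquiv.subtypeEquiv
      fun g ↦ (Subgroup.mem_normalizer_iff_map_conj_eq (H := H) (g := ConjAct.ofConjAct g)).symm
  rw [conjClassSize, normalizerOrder, ← Nat.card_congr e, ← Nat.card_prod,
    Nat.card_congr (MulAction.orbitProdStabilizerEquivGroup (ConjAct G) H)]
  rfl

/-- Primes over $\ell$ are conjugate, hence so are their decomposition groups; the computation may
be done at the pinned prime. -/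
theorem normalizerOrder_decompSubgroup (M : IntermediateField ℚ Qbar) [Normal ℚ M] {ℓ : ℕ}
    (hℓ : ℓ.Prime) (Q : Ideal Zbar) [Q.IsPrime]
    (hQ : (ℓ : Zbar) ∈ Q) (P : Ideal (𝓞 M)) [P.IsPrime] (hP : (ℓ : 𝓞 M) ∈ P) :
    normalizerOrder (decompSubgroup P) =
      normalizerOrder ((decompGroup Q).map (AlgEquiv.restrictNormalHom M)) := by
  obtain ⟨σ, rfl⟩ := exists_eq_contraction_smul M hℓ Q hQ P hP
  rw [← smul_contraction, decompSubgroup, MulAction.stabilizer_smul_eq_stabilizer_map_conj,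
    ← decompSubgroup_contraction]
  exact normalizerOrder_smul _ _

/-! ### Roots of unity and $p$th roots modulo a prime -/

theorem natCast_mem_of_sub_one_mem {R : Type*} [CommRing R] [IsDomain R] {p : ℕ} {η : R}
    (hη : η ^ p = 1) (h1 : η ≠ 1) {P : Ideal R} (h : η - 1 ∈ P) : (p : R) ∈ P := by
  have hsum : ∑ i ∈ Finset.range p, η ^ i = 0 := by
    have := mul_geom_sum η p
    rw [hη, sub_self, mul_eq_zero, sub_eq_zero] at this
    exact this.resolve_left h1
  have hmk : Ideal.Quotient.mk P η = 1 := by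
    rw [← map_one (Ideal.Quotient.mk P)]
    exact Ideal.Quotient.eq.2 h
  have := congrArg (Ideal.Quotient.mk P) hsum
  rw [map_sum] at this
  simp only [map_pow, hmk, one_pow, Finset.sum_const, Finset.card_range, nsmul_eq_mul, mul_one,
    map_zero] at this
  rwa [← map_natCast (Ideal.Quotient.mk P), Ideal.Quotient.eq_zero_iff_mem] at this

theorem smul_sub_mem {P : Ideal Zbar} {σ : GQ} (hσ : σ ∈ decompGroup P) {x : Zbar} {n : ℕ}
    (hx : x - n ∈ P) : σ • x - x ∈ P := by
  have h : σ • (x - n) ∈ P := by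
    have := Ideal.smul_mem_pointwise_smul σ _ P hx
    rwa [show σ • P = P from hσ] at this
  rw [smul_sub, show σ • (n : Zbar) = n from map_natCast (MulSemiringAction.toRingHom GQ Zbar σ) n]
    at h
  have := P.sub_mem h hx
  rwa [sub_sub_sub_cancel_right] at this

/-- As $p\mid\ell-1$, the field $\mathbb F_\ell$ contains the $p$th roots of unity. All $p$th roots
of $u^p$ in the residue ring therefore already lie in $\mathbb F_\ell$. -/
theorem exists_sub_natCast_mem {p ℓ : ℕ} [Fact p.Prime] (hℓ : ℓ.Prime) (h₀ : ℓ ≡ 1 [MOD p])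
    {P : Ideal Zbar} [P.IsPrime] (hP : (ℓ : Zbar) ∈ P) {x : Zbar} {u : ZMod ℓ} {m : ℕ}
    (hm : (m : ZMod ℓ) = u ^ p) (hx : x ^ p = m) : ∃ n : ℕ, x - n ∈ P := by
  have : Fact ℓ.Prime := ⟨hℓ⟩
  have hpos : 0 < p := (Fact.out : p.Prime).pos
  have hdvd : p ∣ Nat.card (ZMod ℓ)ˣ := by
    rw [Nat.card_eq_fintype_card, ZMod.card_units]
    exact (Nat.modEq_iff_dvd' hℓ.one_le).1 h₀.symm
  obtain ⟨v, hv⟩ := exists_prime_orderOf_dvd_card' p hdvd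
  have hv' : IsPrimitiveRoot (v : ZMod ℓ) p := by
    rw [IsPrimitiveRoot.coe_units_iff, ← hv]
    exact IsPrimitiveRoot.orderOf v
  have : CharP (Zbar ⧸ P) ℓ := by
    rw [CharP.charP_iff_prime_eq_zero hℓ, ← map_natCast (Ideal.Quotient.mk P)]
    exact Ideal.Quotient.eq_zero_iff_mem.2 hP
  let φ : ZMod ℓ →+* Zbar ⧸ P := ZMod.castHom dvd_rfl _
  have hφ := hv'.map_of_injective φ.injective
  have hmem : Ideal.Quotient.mk P x ∈ Polynomial.nthRoots p (φ u ^ p) := by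
    rw [Polynomial.mem_nthRoots hpos, ← map_pow, hx, ← map_pow φ, ← hm, map_natCast, map_natCast]
  rw [hφ.nthRoots_eq rfl, Multiset.mem_map] at hmem
  obtain ⟨i, -, hi⟩ := hmem
  refine ⟨((v : ZMod ℓ) ^ i * u).val, Ideal.Quotient.eq.1 ?_⟩
  rw [← hi, ← map_pow, ← map_mul, map_natCast, ← map_natCast φ, ZMod.natCast_zmod_val]

/-- The residue of $x$ lies in $\mathbb F_\ell$, so $\sigma$ fixes it and $(\eta-1)x\in P$. If
$\eta\ne1$, then $p\in P$ or $m\in P$, and both are excluded. The case $m=1$ yields $\omega=1$ on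
the decomposition group, the case $m=\ell_1$ yields $b=0$. -/
theorem eq_one_of_smul_eq_mul {p ℓ : ℕ} [Fact p.Prime] (hℓ : ℓ.Prime) (h₀ : ℓ ≡ 1 [MOD p])
    {P : Ideal Zbar} [P.IsPrime] (hP : (ℓ : Zbar) ∈ P) {m : ℕ} {u : ZMod ℓ}
    (hm : (m : ZMod ℓ) = u ^ p) (hm0 : (m : ZMod ℓ) ≠ 0) {x η : Qbar} (hx : x ^ p = m)
    (hη : η ^ p = 1) {σ : GQ} (hσ : σ ∈ decompGroup P) (h : σ x = η * x) : η = 1 := by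
  have : Fact ℓ.Prime := ⟨hℓ⟩
  have hpos : 0 < p := (Fact.out : p.Prime).pos
  have cast_mem (k : ℕ) (hk : (k : Zbar) ∈ P) : (k : ZMod ℓ) = 0 := by
    have : CharP (Zbar ⧸ P) ℓ := by
      rw [CharP.charP_iff_prime_eq_zero hℓ, ← map_natCast (Ideal.Quotient.mk P)]
      exact Ideal.Quotient.eq_zero_iff_mem.2 hP
    rw [← Ideal.Quotient.eq_zero_iff_mem, map_natCast, CharP.cast_eq_zero_iff _ ℓ] at hk
    rwa [ZMod.natCast_eq_zero_iff]
  have hxi : IsIntegral ℤ x := .of_pow hpos (hx ▸ isIntegral_natCast m)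
  have hηi : IsIntegral ℤ η := .of_pow hpos (hη ▸ isIntegral_one)
  let x' : Zbar := ⟨x, hxi⟩
  let η' : Zbar := ⟨η, hηi⟩
  have hx' : x' ^ p = m := by
    apply FaithfulSMul.algebraMap_injective Zbar Qbar
    rw [map_pow, map_natCast]
    exact hx
  have hη' : η' ^ p = 1 := by
    apply FaithfulSMul.algebraMap_injective Zbar Qbar
    rw [map_pow, map_one]
    exact hη
  have h' : σ • x' = η' * x' := by
    apply FaithfulSMul.algebraMap_injective Zbar Qbar
    rw [map_mul]
    exact h
  obtain ⟨n, hn⟩ := exists_sub_natCast_mem hℓ h₀ hP hm hx'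
  have hmem := smul_sub_mem hσ hn
  rw [h', ← sub_one_mul] at hmem
  by_contra hne
  rcases ‹P.IsPrime›.mem_or_mem hmem with h1 | h1
  · have hp := cast_mem p (natCast_mem_of_sub_one_mem hη'
      (fun e ↦ hne (congrArg (algebraMap Zbar Qbar) e)) h1)
    rw [ZMod.natCast_eq_zero_iff, Nat.prime_dvd_prime_iff_eq hℓ Fact.out] at hp
    subst hp
    have := (Nat.modEq_iff_dvd' hℓ.one_le).1 h₀.symm
    have := Nat.le_of_dvd (Nat.sub_pos_of_lt hℓ.one_lt) this
    have := hℓ.one_lt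
    omega
  · refine hm0 (cast_mem m ?_)
    rw [← hx']
    exact P.pow_mem_of_mem h1 p hpos

/-! ### The cyclotomic character and Kummer cocycles -/

section Cyclotomic

variable {p : ℕ} [Fact p.Prime] {ζ : Qbar}

theorem omega_spec (hζ : IsPrimitiveRoot ζ p) (σ : GQ) : σ ζ = ζ ^ (omega p σ : ZMod p).val := by
  have := modularCyclotomicCharacter.spec Qbar (n := p)
    (HasEnoughRootsOfUnity.natCard_rootsOfUnity Qbar p) (MulSemiringAction.toRingAut GQ Qbar σ)
    (t := hζ.toRootsOfUnity) hζ.toRootsOfUnity.2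
  exact this

theorem pow_val_inj (hζ : IsPrimitiveRoot ζ p) {x y : ZMod p} :
    ζ ^ x.val = ζ ^ y.val ↔ x = y :=
  ⟨fun h ↦ ZMod.val_injective p (hζ.pow_inj x.val_lt y.val_lt h), fun h ↦ h ▸ rfl⟩

theorem pow_val_natCast (hζ : IsPrimitiveRoot ζ p) (n : ℕ) : ζ ^ (n : ZMod p).val = ζ ^ n := by
  rw [ZMod.val_natCast, hζ.eq_orderOf, pow_mod_orderOf]

theorem pow_val_add (hζ : IsPrimitiveRoot ζ p) (x y : ZMod p) :
    ζ ^ (x + y).val = ζ ^ x.val * ζ ^ y.val := by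
  rw [← pow_add, ← pow_val_natCast hζ (x.val + y.val), Nat.cast_add, ZMod.natCast_zmod_val,
    ZMod.natCast_zmod_val]

theorem pow_val_mul (hζ : IsPrimitiveRoot ζ p) (x y : ZMod p) :
    ζ ^ (x * y).val = (ζ ^ x.val) ^ y.val := by
  rw [← pow_mul, ← pow_val_natCast hζ (x.val * y.val), Nat.cast_mul, ZMod.natCast_zmod_val,
    ZMod.natCast_zmod_val]

theorem apply_pow_val (hζ : IsPrimitiveRoot ζ p) (σ : GQ) (x : ZMod p) :
    σ (ζ ^ x.val) = ζ ^ ((omega p σ : ZMod p) * x).val := by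
  rw [map_pow, omega_spec hζ, pow_val_mul hζ]

theorem omega_eq_one_iff (hζ : IsPrimitiveRoot ζ p) (σ : GQ) : omega p σ = 1 ↔ σ ζ = ζ := by
  rw [omega_spec hζ, Units.ext_iff, Units.val_one, ← pow_val_inj hζ, ZMod.val_one, pow_one]

theorem omega_surjective (hζ : IsPrimitiveRoot ζ p) : Function.Surjective (omega p) := by
  intro w
  have hpos : 0 < p := (Fact.out : p.Prime).pos
  have hcop : (w : ZMod p).val.Coprime p := ZMod.val_coe_unit_coprime w
  have hmin : IsConjRoot ℚ (ζ ^ (w : ZMod p).val) ζ := by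
    rw [IsConjRoot, ← Polynomial.cyclotomic_eq_minpoly_rat hζ hpos,
      ← Polynomial.cyclotomic_eq_minpoly_rat (hζ.pow_of_coprime _ hcop) hpos]
  obtain ⟨σ, hσ⟩ := isConjRoot_iff_exists_algEquiv.1 hmin
  refine ⟨σ, Units.ext ?_⟩
  rw [← pow_val_inj hζ, ← omega_spec hζ]
  exact hσ

theorem omega_eq_one_of_mem_decompGroup (hζ : IsPrimitiveRoot ζ p) {ℓ : ℕ} (hℓ : ℓ.Prime)
    (h₀ : ℓ ≡ 1 [MOD p]) {P : Ideal Zbar} [P.IsPrime] (hP : (ℓ : Zbar) ∈ P) {σ : GQ}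
    (hσ : σ ∈ decompGroup P) : omega p σ = 1 := by
  have : Fact ℓ.Prime := ⟨hℓ⟩
  have h := eq_one_of_smul_eq_mul (p := p) hℓ h₀ hP (m := 1) (u := 1) (by simp) (by simp)
    (x := ζ) (η := σ ζ * ζ⁻¹) (by simp [hζ.pow_eq_one])
    (by rw [mul_pow, ← map_pow, inv_pow, hζ.pow_eq_one, map_one, inv_one, mul_one]) hσ
    (by rw [inv_mul_cancel_right₀ (hζ.ne_zero (Fact.out : p.Prime).ne_zero)])
  rw [omega_eq_one_iff hζ]
  exact (mul_inv_eq_one₀ (hζ.ne_zero (Fact.out : p.Prime).ne_zero)).1 h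

section Kummer

variable {r : Qbar} {b : GQ → ZMod p}

theorem IsKummerCocycle.map_mul (hζ : IsPrimitiveRoot ζ p) (hr : r ≠ 0)
    (hb : IsKummerCocycle ζ r b) (σ τ : GQ) : b (σ * τ) = b σ + (omega p σ : ZMod p) * b τ := by
  have h := hb (σ * τ)
  rw [AlgEquiv.mul_apply, hb τ, _root_.map_mul, apply_pow_val hζ, hb σ, ← mul_assoc,
    ← pow_val_add hζ] at h
  rw [← pow_val_inj hζ, ← mul_right_cancel₀ hr h, add_comm]

theorem IsKummerCocycle.eq_zero_iff (hζ : IsPrimitiveRoot ζ p) (hr : r ≠ 0)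
    (hb : IsKummerCocycle ζ r b) (σ : GQ) : b σ = 0 ↔ σ r = r := by
  rw [hb σ, ← pow_val_inj hζ, ZMod.val_zero, pow_zero, mul_eq_right₀ hr]

theorem IsKummerCocycle.eq_zero_of_mem_decompGroup (hζ : IsPrimitiveRoot ζ p)
    (hb : IsKummerCocycle ζ r b) {ℓ m : ℕ} (hℓ : ℓ.Prime)
    (h₀ : ℓ ≡ 1 [MOD p]) {P : Ideal Zbar} [P.IsPrime] (hP : (ℓ : Zbar) ∈ P) {u : ZMod ℓ}
    (hm : (m : ZMod ℓ) = u ^ p) (hm0 : (m : ZMod ℓ) ≠ 0) (hr : r ^ p = m) {σ : GQ}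
    (hσ : σ ∈ decompGroup P) : b σ = 0 := by
  have h := eq_one_of_smul_eq_mul hℓ h₀ hP hm hm0 hr
    (by rw [← pow_mul, mul_comm, pow_mul, hζ.pow_eq_one, one_pow]) hσ (hb σ)
  rwa [← pow_zero ζ, ← ZMod.val_zero (n := p), pow_val_inj hζ] at h

/-- If $b$ vanished on $\ker\omega$, it would be a coboundary. Then some $\zeta^i r$ would be
rational, and $\ell$ would be a $p$th power in $\mathbb Q$. -/
theorem IsKummerCocycle.exists_ne_zero (hp : 3 ≤ p) (hζ : IsPrimitiveRoot ζ p)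
    (hb : IsKummerCocycle ζ r b) {ℓ : ℕ} (hℓ : ℓ.Prime) (hr : r ^ p = ℓ) :
    ∃ σ, omega p σ = 1 ∧ b σ ≠ 0 := by
  have hp0 : p ≠ 0 := (Fact.out : p.Prime).ne_zero
  have hr0 : r ≠ 0 := by
    rintro rfl
    rw [zero_pow hp0] at hr
    exact hℓ.ne_zero (Nat.cast_injective (hr.symm.trans Nat.cast_zero.symm))
  by_contra! hker
  obtain ⟨w, hw⟩ : ∃ w : (ZMod p)ˣ, w ≠ 1 := by
    have : 1 < Fintype.card (ZMod p)ˣ := by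
      rw [ZMod.card_units]
      omega
    have := Fintype.one_lt_card_iff_nontrivial.1 this
    exact exists_ne 1
  obtain ⟨g, rfl⟩ := omega_surjective hζ w
  have hg : (omega p g : ZMod p) - 1 ≠ 0 := fun h ↦ hw (Units.ext (sub_eq_zero.1 h))
  have hmul := hb.map_mul hζ hr0
  -- The commutator of $g$ and $\sigma$ lies in $\ker\omega$; expanding $b(g\sigma)=b(\sigma g)$
  -- compares $b(\sigma)$ with $b(g)$.
  have hcomm (σ : GQ) : b σ * ((omega p g : ZMod p) - 1) = b g * ((omega p σ : ZMod p) - 1) := by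
    have h1 : b ((g * σ)⁻¹ * (σ * g)) = 0 := hker _ (by
      rw [_root_.map_mul, map_inv, _root_.map_mul, _root_.map_mul, mul_comm (omega p g),
        inv_mul_cancel])
    have h2 := hmul (g * σ) ((g * σ)⁻¹ * (σ * g))
    rw [h1, mul_inv_cancel_left, mul_zero, add_zero, hmul, hmul] at h2
    linear_combination -h2
  set x : ZMod p := b g / ((omega p g : ZMod p) - 1) with hx
  have hbx (σ : GQ) : b σ + (omega p σ : ZMod p) * (-x) = -x := by
    have : b σ = x * ((omega p σ : ZMod p) - 1) := by
      rw [hx, div_mul_eq_mul_div, eq_div_iff hg, hcomm]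
    rw [this]
    ring
  obtain ⟨q, hq⟩ := (InfiniteGalois.mem_range_algebraMap_iff_fixed (k := ℚ)
    (ζ ^ (-x).val * r)).2 fun σ ↦ by
      rw [_root_.map_mul, apply_pow_val hζ, hb σ, ← mul_assoc, ← pow_val_add hζ, add_comm, hbx]
  have hqp : q ^ p = ℓ := by
    apply (algebraMap ℚ Qbar).injective
    rw [map_pow, hq, mul_pow, hr, ← pow_mul, mul_comm _ p, pow_mul, hζ.pow_eq_one, one_pow, one_mul,
      map_natCast]
  have : Fact ℓ.Prime := ⟨hℓ⟩
  have hv := congrArg (padicValRat ℓ) hqp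
  rw [padicValRat.pow, padicValRat.of_nat, padicValNat_self] at hv
  have := Int.le_of_dvd one_pos (Dvd.intro _ hv)
  omega

end Kummer

end Cyclotomic

/-! ### Triangular groups in coordinates: surjectivity, conjugation, normalizers -/

section Coordinates

variable {p : ℕ} [Fact p.Prime] {G : Type*} [Group G]

/-- The coordinates `b`, `c`, `a` of the representation `[w, b, wa; 0, 1, wc; 0, 0, w]`. -/
structure IsTriangular₃ (w : G →* (ZMod p)ˣ) (b c a : G → ZMod p) : Prop where
  b_mul : ∀ σ τ, b (σ * τ) = b σ + w σ * b τ
  c_mul : ∀ σ τ, c (σ * τ) = c σ + (w σ : ZMod p)⁻¹ * c τ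
  a_mul : ∀ σ τ, a (σ * τ) = a σ + a τ + b σ * ((w σ : ZMod p)⁻¹ * c τ)

/-- The coordinates of the representation
`[w, b, wa, y; 0, 1, wc, bc - a; 0, 0, w, b; 0, 0, 0, 1]`. -/
structure IsTriangular₄ (w : G →* (ZMod p)ˣ) (b c a y : G → ZMod p) : Prop
    extends IsTriangular₃ w b c a where
  y_mul : ∀ σ τ, y (σ * τ) = y σ + w σ * y τ + a σ * (w σ * b τ) + b σ * (b τ * c τ - a τ)

theorem exists_eq_of_additiveOn {S : G → Prop} (hS : ∀ x y, S x → S y → S (x * y))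
    {φ : G → ZMod p} (hφ : ∀ x y, S x → S y → φ (x * y) = φ x + φ y) {z : G} (hz : S z)
    (hne : φ z ≠ 0) (v : ZMod p) : ∃ k, S k ∧ φ k = v := by
  have hpow (n : ℕ) : S (z ^ (n + 1)) ∧ φ (z ^ (n + 1)) = (n + 1 : ℕ) * φ z := by
    induction n with
    | zero => simpa using hz
    | succ n ih =>
      rw [pow_succ z (n + 1)]
      refine ⟨hS _ _ ih.1 hz, ?_⟩
      rw [hφ _ _ ih.1 hz, ih.2]
      push_cast
      ring
  -- `S` is only closed under products and need not be known to contain $1$, so the exponent is kept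
  -- positive.
  refine ⟨z ^ ((v / φ z - 1).val + 1), (hpow _).1, ?_⟩
  rw [(hpow _).2, Nat.cast_add, ZMod.natCast_zmod_val, Nat.cast_one, sub_add_cancel,
    div_mul_cancel₀ _ hne]

variable {w : G →* (ZMod p)ˣ} {b c a y : G → ZMod p}

namespace IsTriangular₃

variable (h : IsTriangular₃ w b c a)
include h

/-- This is the Heisenberg relation: the commutator of $s$ and $\gamma$ is central in $\ker w$, with
$a$-coordinate $b(s)c(\gamma)$. -/
theorem exists_commutator {s γ : G} (hws : w s = 1) (hwγ : w γ = 1) (hbγ : b γ = 0)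
    (hcγ : c γ = 1) : ∃ t, w t = 1 ∧ b t = 0 ∧ c t = 0 ∧ a t = b s := by
  set t := (γ * s)⁻¹ * (s * γ) with ht
  have hmul : γ * s * t = s * γ := mul_inv_cancel_left _ _
  have hwt : w t = 1 := by simp [ht, hws, hwγ]
  have hwγs : w (γ * s) = 1 := by simp [hws, hwγ]
  have hb := congrArg b hmul
  have hc := congrArg c hmul
  have ha := congrArg a hmul
  simp only [h.b_mul, h.c_mul, h.a_mul, hws, hwγ, hbγ, hcγ, hwγs, Units.val_one, inv_one] at hb hc ha
  have hct : c t = 0 := by linear_combination hc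
  rw [hct] at ha
  exact ⟨t, hwt, by linear_combination hb, hct, by linear_combination ha⟩

/-- An element with the right $w$ is corrected on the right by elements of $\ker w$, $\ker(w,b)$ and
$\ker(w,b,c)$ in turn. On these groups $b$, $c$ and $a$ respectively are additive, and nonzero at
$s$, $\gamma$ and the commutator $t$. -/
theorem exists_coordinates (hw : Function.Surjective w) {s γ : G} (hws : w s = 1) (hbs : b s ≠ 0)
    (hwγ : w γ = 1) (hbγ : b γ = 0) (hcγ : c γ = 1) (w₀ : (ZMod p)ˣ) (b₀ c₀ a₀ : ZMod p) :
    ∃ σ, w σ = w₀ ∧ b σ = b₀ ∧ c σ = c₀ ∧ a σ = a₀ := by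
  obtain ⟨t, hwt, hbt, hct, hat⟩ := h.exists_commutator hws hwγ hbγ hcγ
  obtain ⟨σ, rfl⟩ := hw w₀
  have hne := (w σ).ne_zero
  obtain ⟨k₁, hk₁, hb₁⟩ := exists_eq_of_additiveOn (S := fun x ↦ w x = 1)
    (fun x y hx hy ↦ by rw [map_mul, hx, hy, one_mul]) (φ := b)
    (fun x y hx hy ↦ by rw [h.b_mul, hx, Units.val_one, one_mul]) hws hbs
    ((w σ : ZMod p)⁻¹ * (b₀ - b σ))
  obtain ⟨k₂, hk₂, hc₂⟩ := exists_eq_of_additiveOn (S := fun x ↦ w x = 1 ∧ b x = 0)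
    (fun x y hx hy ↦ by simp [h.b_mul, hx.1, hx.2, hy.1, hy.2]) (φ := c)
    (fun x y hx hy ↦ by simp [h.c_mul, hx.1]) ⟨hwγ, hbγ⟩ (hcγ ▸ one_ne_zero)
    ((w σ : ZMod p) * (c₀ - c (σ * k₁)))
  obtain ⟨k₃, hk₃, ha₃⟩ := exists_eq_of_additiveOn (S := fun x ↦ w x = 1 ∧ b x = 0 ∧ c x = 0)
    (fun x y hx hy ↦ by simp [h.b_mul, h.c_mul, hx, hy]) (φ := a)
    (fun x y hx hy ↦ by simp [h.a_mul, hx]) ⟨hwt, hbt, hct⟩ (hat ▸ hbs)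
    (a₀ - a (σ * k₁ * k₂))
  have hw₁ : w (σ * k₁) = w σ := by rw [map_mul, hk₁, mul_one]
  have hw₂ : w (σ * k₁ * k₂) = w σ := by rw [map_mul, hk₂.1, mul_one, hw₁]
  refine ⟨σ * k₁ * k₂ * k₃, by rw [map_mul, hk₃.1, mul_one, hw₂], ?_, ?_, ?_⟩
  · rw [h.b_mul, hk₃.2.1, h.b_mul (σ * k₁), hk₂.2, h.b_mul, hb₁, mul_inv_cancel_left₀ hne]
    ring
  · rw [h.c_mul, hk₃.2.2, h.c_mul (σ * k₁), hc₂, hw₁, inv_mul_cancel_left₀ hne]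
    ring
  · rw [h.a_mul, hk₃.2.2, ha₃]
    ring

end IsTriangular₃

theorem IsTriangular₄.exists_coordinates (h : IsTriangular₄ w b c a y) (hp : p ≠ 2)
    (hw : Function.Surjective w) {s γ : G} (hws : w s = 1)
    (hbs : b s ≠ 0) (hwγ : w γ = 1) (hbγ : b γ = 0) (hcγ : c γ = 1) (w₀ : (ZMod p)ˣ)
    (b₀ c₀ a₀ y₀ : ZMod p) :
    ∃ σ, w σ = w₀ ∧ b σ = b₀ ∧ c σ = c₀ ∧ a σ = a₀ ∧ y σ = y₀ := by
  obtain ⟨t, hwt, hbt, hct, hat⟩ := h.exists_commutator hws hwγ hbγ hcγ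
  obtain ⟨σ, rfl, rfl, rfl, rfl⟩ := h.toIsTriangular₃.exists_coordinates hw hws hbs hwγ hbγ hcγ
    w₀ b₀ c₀ a₀
  have hne := (w σ).ne_zero
  -- A second commutator moves only $y$: the terms $a\smile b$ and $b\smile d$ contribute with equal
  -- sign, giving $-2b(s)^2$, nonzero for odd $p$.
  set u := (t * s)⁻¹ * (s * t) with hu
  have hmul : t * s * u = s * t := mul_inv_cancel_left _ _
  have hwu : w u = 1 := by simp [hu, hws, hwt]
  have hwts : w (t * s) = 1 := by simp [hws, hwt]
  have hb := congrArg b hmul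
  have hc := congrArg c hmul
  have ha := congrArg a hmul
  have hy := congrArg y hmul
  simp only [h.b_mul, h.c_mul, h.a_mul, h.y_mul, hws, hwt, hbt, hct, hwts, hat, Units.val_one,
    inv_one] at hb hc ha hy
  have hbu : b u = 0 := by linear_combination hb
  have hcu : c u = 0 := by linear_combination hc
  rw [hcu] at ha
  have hau : a u = 0 := by linear_combination ha
  rw [hbu, hcu, hau] at hy
  have hyu : y u = -2 * b s ^ 2 := by linear_combination hy
  have h2 : (2 : ZMod p) ≠ 0 := fun h2 ↦ hp (by
    have : (p : ℕ) ∣ 2 := (ZMod.natCast_eq_zero_iff 2 p).1 (by exact_mod_cast h2)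
    exact (Nat.prime_dvd_prime_iff_eq Fact.out Nat.prime_two).1 this)
  obtain ⟨k, ⟨hk, hbk, hck, hak⟩, hyk⟩ := exists_eq_of_additiveOn
    (S := fun x ↦ w x = 1 ∧ b x = 0 ∧ c x = 0 ∧ a x = 0)
    (fun x x' ⟨h₁, h₂, h₃, h₄⟩ ⟨h₁', h₂', h₃', h₄'⟩ ↦ by
      simp only [map_mul, h.b_mul, h.c_mul, h.a_mul, h₁, h₂, h₃, h₄, h₁', h₂', h₃', h₄', mul_zero,
        mul_one, add_zero, and_self]) (φ := y)
    (fun x x' ⟨h₁, h₂, h₃, h₄⟩ ⟨h₁', h₂', h₃', h₄'⟩ ↦ by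
      simp only [h.y_mul, h₁, h₂, h₄, h₂', Units.val_one, one_mul, mul_zero, zero_mul,
        add_zero]) ⟨hwu, hbu, hcu, hau⟩
    (hyu ▸ mul_ne_zero (neg_ne_zero.2 h2) (pow_ne_zero 2 hbs))
    ((w σ : ZMod p)⁻¹ * (y₀ - y σ))
  refine ⟨σ * k, by rw [map_mul, hk, mul_one], by rw [h.b_mul, hbk, mul_zero, add_zero],
    by rw [h.c_mul, hck, mul_zero, add_zero],
    by rw [h.a_mul, hck, hak, mul_zero, mul_zero, add_zero, add_zero], ?_⟩
  rw [h.y_mul, hbk, hck, hak, hyk, mul_inv_cancel_left₀ hne]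
  ring

theorem exists_equiv_of_surjective {G Q T : Type*} {π : G → Q} {f : G → T}
    (hπ : Function.Surjective π) (hf : Function.Surjective f)
    (hfib : ∀ σ τ, π σ = π τ ↔ f σ = f τ) : ∃ e : Q ≃ T, ∀ σ, e (π σ) = f σ := by
  have key (σ : G) : f (Function.surjInv hπ (π σ)) = f σ :=
    (hfib _ _).1 (Function.surjInv_eq hπ _)
  refine ⟨Equiv.ofBijective (f ∘ Function.surjInv hπ) ⟨fun x y hxy ↦ ?_, fun t ↦ ?_⟩, key⟩
  · have := (hfib _ _).2 hxy
    rwa [Function.surjInv_eq hπ, Function.surjInv_eq hπ] at this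
  · obtain ⟨σ, rfl⟩ := hf t
    exact ⟨π σ, key σ⟩

theorem mem_normalizer_of_forall {H : Subgroup G} {σ : G} (h : ∀ τ ∈ H, σ * τ * σ⁻¹ ∈ H)
    (h' : ∀ τ ∈ H, σ⁻¹ * τ * σ ∈ H) : σ ∈ Subgroup.normalizer (H : Set G) := by
  refine Subgroup.mem_normalizer_iff.2 fun τ ↦ ⟨h τ, fun hτ ↦ ?_⟩
  have := h' _ hτ
  group at this
  simpa using this

theorem inv_coordinates₃ (h : IsTriangular₃ w b c a) (σ : G) :
    b σ⁻¹ = -((w σ : ZMod p)⁻¹ * b σ) := by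
  have hb := h.b_mul σ⁻¹ σ
  have hb1 := h.b_mul 1 1
  simp only [map_one, mul_one, Units.val_one, one_mul, left_eq_add] at hb1
  rw [inv_mul_cancel, hb1, map_inv, Units.val_inv_eq_inv_val] at hb
  linear_combination -hb

/-- The effect of conjugation on an element `τ` with `w τ = 1` and `b τ = 0`. -/
theorem conj_coordinates₃ (h : IsTriangular₃ w b c a) {τ : G} (hw : w τ = 1) (hb : b τ = 0)
    (σ : G) : w (σ * τ * σ⁻¹) = 1 ∧ b (σ * τ * σ⁻¹) = 0 ∧
      c (σ * τ * σ⁻¹) = (w σ : ZMod p)⁻¹ * c τ ∧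
      a (σ * τ * σ⁻¹) = a τ + b σ * (w σ : ZMod p)⁻¹ * c τ := by
  set ρ := σ * τ * σ⁻¹ with hρ
  have hmul : ρ * σ = σ * τ := inv_mul_cancel_right _ _
  have hwρ : w ρ = 1 := by simp [hρ, hw]
  have hb' := congrArg b hmul
  have hc' := congrArg c hmul
  have ha' := congrArg a hmul
  simp only [h.b_mul, h.c_mul, h.a_mul, hwρ, hb, Units.val_one, inv_one] at hb' hc' ha'
  have hbρ : b ρ = 0 := by linear_combination hb'
  rw [hbρ] at ha'
  exact ⟨hwρ, hbρ, by linear_combination hc', by linear_combination ha'⟩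

theorem conj_coordinates₄ (h : IsTriangular₄ w b c a y) {τ : G} (hw : w τ = 1) (hb : b τ = 0)
    (σ : G) : y (σ * τ * σ⁻¹) =
      w σ * y τ - 2 * (b σ * a τ) - b σ ^ 2 * (w σ : ZMod p)⁻¹ * c τ := by
  obtain ⟨hwρ, hbρ, hcρ, haρ⟩ := conj_coordinates₃ h.toIsTriangular₃ hw hb σ
  set ρ := σ * τ * σ⁻¹ with hρ
  have hmul : ρ * σ = σ * τ := inv_mul_cancel_right _ _
  have hy' := congrArg y hmul
  simp only [h.y_mul, hwρ, hbρ, haρ, hb, Units.val_one] at hy'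
  linear_combination hy'

/-- Testing the conjugate of the single element $\gamma$ already forces the condition. Conversely
the condition is linear in $c(\tau)$ and stable under $\sigma\mapsto\sigma^{-1}$. -/
theorem mem_normalizer_iff₃ (h : IsTriangular₃ w b c a) {α : ZMod p} {H : Subgroup G}
    (hH : ∀ τ, τ ∈ H ↔ w τ = 1 ∧ b τ = 0 ∧ a τ = α * c τ) {γ : G} (hγ : γ ∈ H) (hcγ : c γ = 1)
    (σ : G) : σ ∈ Subgroup.normalizer (H : Set G) ↔ b σ = α * (1 - w σ) := by
  have hne (σ : G) := (w σ).ne_zero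
  constructor
  · intro hσ
    have hmem := (Subgroup.mem_normalizer_iff.1 hσ γ).1 hγ
    obtain ⟨hw, hb, ha⟩ := (hH γ).1 hγ
    obtain ⟨-, -, hc', ha'⟩ := conj_coordinates₃ h hw hb σ
    have ha₁ := ((hH _).1 hmem).2.2
    rw [hc', ha', ha, hcγ] at ha₁
    have := hne σ
    field_simp at ha₁
    linear_combination ha₁
  · have key (σ : G) (hσ : b σ = α * (1 - w σ)) (τ : G) (hτ : τ ∈ H) : σ * τ * σ⁻¹ ∈ H := by
      obtain ⟨hw, hb, ha⟩ := (hH τ).1 hτ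
      obtain ⟨hw', hb', hc', ha'⟩ := conj_coordinates₃ h hw hb σ
      refine (hH _).2 ⟨hw', hb', ?_⟩
      rw [hc', ha', ha, hσ]
      have := hne σ
      field_simp
      ring
    intro hσ
    refine mem_normalizer_of_forall (key σ hσ) fun τ hτ ↦ ?_
    have := key σ⁻¹ (by
      rw [inv_coordinates₃ h, hσ, map_inv, Units.val_inv_eq_inv_val]
      have := hne σ
      field_simp
      ring) τ hτ
    rwa [inv_inv] at this

/-- Substituting $b=\alpha(1-w)$ into $w^2\beta-2w\alpha b-b^2=\beta$, the condition on the
$y$-coordinate of the conjugate of $\gamma$, makes it factor as $(w^2-1)(\alpha^2+\beta)=0$. -/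
theorem mem_normalizer_iff₄ (h : IsTriangular₄ w b c a y) {α β : ZMod p} {H : Subgroup G}
    (hH : ∀ τ, τ ∈ H ↔ w τ = 1 ∧ b τ = 0 ∧ a τ = α * c τ ∧ y τ = β * c τ) {γ : G} (hγ : γ ∈ H)
    (hcγ : c γ = 1) (σ : G) : σ ∈ Subgroup.normalizer (H : Set G) ↔
      b σ = α * (1 - w σ) ∧ ((w σ : ZMod p) ^ 2 - 1) * (α ^ 2 + β) = 0 := by
  have hne (σ : G) := (w σ).ne_zero
  constructor
  · intro hσ
    have hmem := (Subgroup.mem_normalizer_iff.1 hσ γ).1 hγ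
    obtain ⟨hw, hb, ha, hy⟩ := (hH γ).1 hγ
    obtain ⟨-, -, hc', ha'⟩ := conj_coordinates₃ h.toIsTriangular₃ hw hb σ
    have hy' := conj_coordinates₄ h hw hb σ
    obtain ⟨-, -, ha₁, hy₁⟩ := (hH _).1 hmem
    rw [hc', ha', ha, hcγ] at ha₁
    rw [hc', hy', hy, ha, hcγ] at hy₁
    have := hne σ
    field_simp at ha₁ hy₁
    have hbσ : b σ = α * (1 - w σ) := by linear_combination ha₁
    refine ⟨hbσ, ?_⟩
    rw [hbσ] at hy₁
    linear_combination hy₁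
  · have key (σ : G) (hσ : b σ = α * (1 - w σ))
        (hσ' : ((w σ : ZMod p) ^ 2 - 1) * (α ^ 2 + β) = 0) (τ : G) (hτ : τ ∈ H) :
        σ * τ * σ⁻¹ ∈ H := by
      obtain ⟨hw, hb, ha, hy⟩ := (hH τ).1 hτ
      obtain ⟨hw', hb', hc', ha'⟩ := conj_coordinates₃ h.toIsTriangular₃ hw hb σ
      have := hne σ
      refine (hH _).2 ⟨hw', hb', ?_, ?_⟩
      · rw [hc', ha', ha, hσ]
        field_simp
        ring
      · rw [hc', conj_coordinates₄ h hw hb σ, ha, hy, hσ]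
        field_simp
        linear_combination c τ * hσ'
    rintro ⟨hσ, hσ'⟩
    refine mem_normalizer_of_forall (key σ hσ hσ') fun τ hτ ↦ ?_
    have hne' := hne σ
    have := key σ⁻¹ (by
      rw [inv_coordinates₃ h.toIsTriangular₃, hσ, map_inv, Units.val_inv_eq_inv_val]
      field_simp
      ring) (by
      rw [map_inv, Units.val_inv_eq_inv_val]
      field_simp
      linear_combination -hσ') τ hτ
    rwa [inv_inv] at this

theorem card_units_mul_eq_zero (hp : p ≠ 2) (i : ZMod p) :
    Nat.card {u : (ZMod p)ˣ // ((u : ZMod p) ^ 2 - 1) * i = 0} = if i = 0 then p - 1 else 2 := by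
  split_ifs with hi
  · subst hi
    simp only [mul_zero]
    rw [Nat.card_congr (Equiv.subtypeUnivEquiv fun _ ↦ trivial), Nat.card_eq_fintype_card,
      ZMod.card_units]
  · have : {u : (ZMod p)ˣ | ((u : ZMod p) ^ 2 - 1) * i = 0} = {1, -1} := by
      ext u
      rw [Set.mem_ofPred_eq, mul_eq_zero, or_iff_left hi, sub_eq_zero, sq_eq_one_iff,
        Set.mem_insert_iff, Set.mem_singleton_iff, Units.ext_iff, Units.ext_iff]
      rfl
    change Nat.card {u : (ZMod p)ˣ | ((u : ZMod p) ^ 2 - 1) * i = 0} = 2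
    rw [this, Nat.card_coe_set_eq, Set.ncard_pair]
    intro h1
    have : Fact (2 < p) := ⟨lt_of_le_of_ne (Fact.out : p.Prime).two_le hp.symm⟩
    exact ZMod.neg_one_ne_one (n := p) (by simpa using (Units.ext_iff.1 h1).symm)

theorem card_subtype_prod {U F X : Type*} (g : U → F) (S : U → Prop) :
    Nat.card {t : U × F × X // t.2.1 = g t.1 ∧ S t.1} = Nat.card {u // S u} * Nat.card X := by
  rw [← Nat.card_prod]
  exact Nat.card_congr
    { toFun := fun t ↦ (⟨t.1.1, t.2.2⟩, t.1.2.2)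
      invFun := fun t ↦ ⟨(t.1.1, g t.1.1, t.2), rfl, t.1.2⟩
      left_inv := by
        rintro ⟨⟨u, x, z⟩, hx, hu⟩
        simp only at hx
        subst hx
        rfl
      right_inv := fun _ ↦ rfl }

theorem normalizerOrder_map_eq_card {Q T : Type*} [Group Q] {π : G →* Q}
    (hπ : Function.Surjective π) {f : G → T} (e : Q ≃ T) (he : ∀ σ, e (π σ) = f σ)
    {D : Subgroup G} {S : T → Prop} (hS : ∀ σ,
      σ ∈ Subgroup.normalizer (((D.map π).comap π : Subgroup G) : Set G) ↔ S (f σ)) :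
    normalizerOrder (D.map π) = Nat.card {t // S t} := by
  refine Nat.card_congr (e.subtypeEquiv fun q ↦ ?_)
  obtain ⟨σ, rfl⟩ := hπ q
  rw [he, ← hS, ← Subgroup.comap_normalizer_eq_of_surjective _ hπ, Subgroup.mem_comap]

variable {Q : Type*} [Group Q] {π : G →* Q} (hπ : Function.Surjective π) {D : Subgroup G} {γ : G}

include hπ

theorem normalizerOrder_of_isTriangular₃ (h : IsTriangular₃ w b c a)
    (hfib : ∀ σ τ, π σ = π τ ↔ w σ = w τ ∧ b σ = b τ ∧ c σ = c τ ∧ a σ = a τ)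
    (hw : Function.Surjective w) {s : G} (hws : w s = 1) (hbs : b s ≠ 0) {α : ZMod p}
    (hD : ∀ τ ∈ D, w τ = 1 ∧ b τ = 0 ∧ a τ = α * c τ) (hγ : γ ∈ D) (hcγ : c γ = 1) :
    normalizerOrder (D.map π) = p ^ 2 * (p - 1) := by
  have hsurj : Function.Surjective fun σ ↦ (w σ, b σ, c σ, a σ) := fun ⟨w₀, b₀, c₀, a₀⟩ ↦ by
    obtain ⟨σ, rfl, rfl, rfl, rfl⟩ := h.exists_coordinates hw hws hbs (hD γ hγ).1 (hD γ hγ).2.1 hcγ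
      w₀ b₀ c₀ a₀
    exact ⟨σ, rfl⟩
  obtain ⟨e, he⟩ := exists_equiv_of_surjective hπ hsurj (by simpa using hfib)
  -- $D$ surjects onto the line: $c$ is additive on it and $c(\gamma)=1$, so every value of $c$ is
  -- attained, and it determines the other coordinates.
  have hH (τ : G) : τ ∈ (D.map π).comap π ↔ w τ = 1 ∧ b τ = 0 ∧ a τ = α * c τ := by
    constructor
    · rintro ⟨δ, hδ, hδτ⟩
      obtain ⟨hw', hb', hc', ha'⟩ := (hfib _ _).1 hδτ
      rw [← hw', ← hb', ← hc', ← ha']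
      exact hD δ hδ
    · rintro ⟨hwτ, hbτ, haτ⟩
      obtain ⟨k, hk, hck⟩ := exists_eq_of_additiveOn (S := (· ∈ D)) (fun _ _ ↦ D.mul_mem) (φ := c)
        (fun x y hx _ ↦ by simp [h.c_mul, (hD x hx).1]) hγ (hcγ ▸ one_ne_zero) (c τ)
      obtain ⟨hwk, hbk, hak⟩ := hD k hk
      exact ⟨k, hk, (hfib _ _).2 ⟨hwk.trans hwτ.symm, hbk.trans hbτ.symm, hck, by
        rw [hak, hck, haτ]⟩⟩
  rw [normalizerOrder_map_eq_card hπ e he (S := fun t ↦ t.2.1 = α * (1 - (t.1 : ZMod p)) ∧ True)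
    fun σ ↦ by
      rw [and_true]
      exact mem_normalizer_iff₃ h hH (Subgroup.mem_map_of_mem π hγ) hcγ σ,
    card_subtype_prod (fun u : (ZMod p)ˣ ↦ α * (1 - (u : ZMod p))) fun _ ↦ True,
    Nat.card_congr (Equiv.subtypeUnivEquiv fun _ ↦ trivial), Nat.card_eq_fintype_card,
    ZMod.card_units, Nat.card_prod, Nat.card_zmod]
  ring

theorem card_of_isTriangular₄ (h : IsTriangular₄ w b c a y) (hp : p ≠ 2)
    (hfib : ∀ σ τ, π σ = π τ ↔ w σ = w τ ∧ b σ = b τ ∧ c σ = c τ ∧ a σ = a τ ∧ y σ = y τ)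
    (hw : Function.Surjective w) {s : G} (hws : w s = 1) (hbs : b s ≠ 0) {α β : ZMod p}
    (hD : ∀ τ ∈ D, w τ = 1 ∧ b τ = 0 ∧ a τ = α * c τ ∧ y τ = β * c τ) (hγ : γ ∈ D)
    (hcγ : c γ = 1) :
    Nat.card Q = p ^ 4 * (p - 1) ∧
      normalizerOrder (D.map π) = if α ^ 2 + β = 0 then p ^ 3 * (p - 1) else 2 * p ^ 3 := by
  have hsurj : Function.Surjective fun σ ↦ (w σ, b σ, c σ, a σ, y σ) :=
    fun ⟨w₀, b₀, c₀, a₀, y₀⟩ ↦ by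
      obtain ⟨σ, rfl, rfl, rfl, rfl, rfl⟩ := h.exists_coordinates hp hw hws hbs (hD γ hγ).1
        (hD γ hγ).2.1 hcγ w₀ b₀ c₀ a₀ y₀
      exact ⟨σ, rfl⟩
  obtain ⟨e, he⟩ := exists_equiv_of_surjective hπ hsurj (by simpa using hfib)
  refine ⟨?_, ?_⟩
  · rw [Nat.card_congr e]
    simp only [Nat.card_prod, Nat.card_zmod]
    rw [Nat.card_eq_fintype_card, ZMod.card_units]
    ring
  have hH (τ : G) : τ ∈ (D.map π).comap π ↔
      w τ = 1 ∧ b τ = 0 ∧ a τ = α * c τ ∧ y τ = β * c τ := by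
    constructor
    · rintro ⟨δ, hδ, hδτ⟩
      obtain ⟨hw', hb', hc', ha', hy'⟩ := (hfib _ _).1 hδτ
      rw [← hw', ← hb', ← hc', ← ha', ← hy']
      exact hD δ hδ
    · rintro ⟨hwτ, hbτ, haτ, hyτ⟩
      obtain ⟨k, hk, hck⟩ := exists_eq_of_additiveOn (S := (· ∈ D)) (fun _ _ ↦ D.mul_mem) (φ := c)
        (fun x y hx _ ↦ by simp [h.c_mul, (hD x hx).1]) hγ (hcγ ▸ one_ne_zero) (c τ)
      obtain ⟨hwk, hbk, hak, hyk⟩ := hD k hk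
      exact ⟨k, hk, (hfib _ _).2 ⟨hwk.trans hwτ.symm, hbk.trans hbτ.symm, hck, by
        rw [hak, hck, haτ], by rw [hyk, hck, hyτ]⟩⟩
  rw [normalizerOrder_map_eq_card hπ e he (S := fun t ↦ t.2.1 = α * (1 - (t.1 : ZMod p)) ∧
      ((t.1 : ZMod p) ^ 2 - 1) * (α ^ 2 + β) = 0)
    fun σ ↦ mem_normalizer_iff₄ h hH (Subgroup.mem_map_of_mem π hγ) hcγ σ,
    card_subtype_prod (fun u : (ZMod p)ˣ ↦ α * (1 - (u : ZMod p)))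
      fun u ↦ ((u : ZMod p) ^ 2 - 1) * (α ^ 2 + β) = 0,
    card_units_mul_eq_zero hp, Nat.card_prod, Nat.card_prod, Nat.card_zmod]
  split_ifs <;> ring

end Coordinates

/-! ### Fields cut out by the representations -/

section CutOut

variable {p : ℕ} [Fact p.Prime] {n : Type} [Fintype n] [DecidableEq n]

/-- The infinite Galois correspondence returns only closed subgroups, hence the hypothesis that the
kernel is closed. -/
theorem fixingSubgroup_cutOut {f : GQ → Matrix n n (ZMod p)} (ρ : GQ →* Matrix n n (ZMod p))
    (hf : f = ρ) (hclosed : IsClosed {σ : GQ | ρ σ = 1}) :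
    (cutOut f).fixingSubgroup = ρ.ker := by
  rw [hf, cutOut, show {σ : GQ | ρ σ = 1} = (ρ.ker : Set GQ) from rfl, Subgroup.closure_eq]
  exact InfiniteGalois.fixingSubgroup_fixedField ⟨ρ.ker, hclosed⟩

theorem normal_cutOut {f : GQ → Matrix n n (ZMod p)} (ρ : GQ →* Matrix n n (ZMod p))
    (hf : f = ρ) (hclosed : IsClosed {σ : GQ | ρ σ = 1}) : Normal ℚ (cutOut f) := by
  have h : (cutOut f).fixingSubgroup.Normal := by
    rw [fixingSubgroup_cutOut ρ hf hclosed]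
    infer_instance
  exact ((InfiniteGalois.normal_iff_isGalois _).1 h).to_normal

theorem restrictNormalHom_eq_iff {M : IntermediateField ℚ Qbar} [Normal ℚ M]
    (ρ : GQ →* Matrix n n (ZMod p)) (hM : M.fixingSubgroup = ρ.ker) (σ τ : GQ) :
    AlgEquiv.restrictNormalHom M σ = AlgEquiv.restrictNormalHom M τ ↔ ρ σ = ρ τ := by
  have hker : (AlgEquiv.restrictNormalHom M : GQ →* Gal(M/ℚ)).ker = ρ.ker := by
    rw [← hM]
    exact @IntermediateField.restrictNormalHom_ker ℚ Qbar _ _ _ M ‹Normal ℚ M›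
  rw [MonoidHom.eq_iff, hker, MonoidHom.eq_iff]

end CutOut

section Representations

variable {p ℓ₀ ℓ₁ : ℕ} [Fact p.Prime] {D : PinningData p ℓ₀ ℓ₁}

theorem tw_zero (σ : GQ) : tw (p := p) 0 σ = 1 := by simp [tw]

theorem tw_one (σ : GQ) : tw (p := p) 1 σ = omega p σ := by simp [tw]

theorem tw_neg_one (σ : GQ) : tw (p := p) (-1) σ = (omega p σ : ZMod p)⁻¹ := by
  rw [tw, zpow_neg_one, Units.val_inv_eq_inv_val]

theorem PinningData.root₁_ne_zero (D : PinningData p ℓ₀ ℓ₁) (hℓ₁ : ℓ₁.Prime) : D.root₁ ≠ 0 := by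
  intro h
  have := D.root₁_pow
  rw [h, zero_pow (Fact.out : p.Prime).ne_zero] at this
  exact hℓ₁.ne_zero (Nat.cast_injective (this.symm.trans Nat.cast_zero.symm))

variable {C : PinnedCocycles D} {a b₂ : GQ → ZMod p}

theorem IsA1.isTriangular₃ (ha : IsA1 C a) (hℓ₁ : ℓ₁.Prime) :
    IsTriangular₃ (omega p) C.b C.c a where
  b_mul := C.kummer₁.map_mul D.isPrimitiveRoot (D.root₁_ne_zero hℓ₁)
  c_mul σ τ := by
    have := C.c_cocycle σ τ
    rw [d1, tw_neg_one] at this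
    linear_combination -this
  a_mul σ τ := by
    have := ha.eqn σ τ
    rw [d1, cup, tw_neg_one, tw_zero] at this
    linear_combination this

theorem IsB2.isTriangular₄ (ha : IsA1 C a) (hb₂ : IsB2 C a b₂) (hℓ₁ : ℓ₁.Prime) :
    IsTriangular₄ (omega p) C.b C.c a b₂ where
  toIsTriangular₃ := ha.isTriangular₃ hℓ₁
  y_mul σ τ := by
    have := hb₂.solves.2 σ τ
    rw [d1, cup, cup, tw_one, tw_zero, dCochain] at this
    linear_combination this

theorem upsilon_eq_iff (σ τ : GQ) : upsilon C a σ = upsilon C a τ ↔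
    omega p σ = omega p τ ∧ C.b σ = C.b τ ∧ C.c σ = C.c τ ∧ a σ = a τ := by
  constructor
  · intro h
    have h00 := congrFun (congrFun h 0) 0
    have h01 := congrFun (congrFun h 0) 1
    have h02 := congrFun (congrFun h 0) 2
    have h12 := congrFun (congrFun h 1) 2
    simp only [upsilon, tw_one, Matrix.of_apply, Matrix.cons_val] at h00 h01 h02 h12
    rw [h00] at h02 h12
    exact ⟨Units.ext h00, h01, mul_left_cancel₀ (omega p τ).ne_zero h12,
      mul_left_cancel₀ (omega p τ).ne_zero h02⟩
  · rintro ⟨hw, hb, hc, ha⟩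
    simp only [upsilon, tw_one, hw, hb, hc, ha]

theorem nuRep_eq_iff (σ τ : GQ) : nuRep C a b₂ σ = nuRep C a b₂ τ ↔
    omega p σ = omega p τ ∧ C.b σ = C.b τ ∧ C.c σ = C.c τ ∧ a σ = a τ ∧ b₂ σ = b₂ τ := by
  constructor
  · intro h
    have h00 := congrFun (congrFun h 0) 0
    have h01 := congrFun (congrFun h 0) 1
    have h02 := congrFun (congrFun h 0) 2
    have h03 := congrFun (congrFun h 0) 3
    have h12 := congrFun (congrFun h 1) 2
    simp only [nuRep, tw_one, Matrix.of_apply, Matrix.cons_val] at h00 h01 h02 h12 h03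
    rw [h00] at h02 h12
    exact ⟨Units.ext h00, h01, mul_left_cancel₀ (omega p τ).ne_zero h12,
      mul_left_cancel₀ (omega p τ).ne_zero h02, h03⟩
  · rintro ⟨hw, hb, hc, ha, hb₂⟩
    simp only [nuRep, dCochain, tw_one, hw, hb, hc, ha, hb₂]

theorem upsilon_mul (h : IsTriangular₃ (omega p) C.b C.c a) (σ τ : GQ) :
    upsilon C a (σ * τ) = upsilon C a σ * upsilon C a τ := by
  have := (omega p σ).ne_zero
  ext i j
  fin_cases i <;> fin_cases j <;>
    simp [-ZMod.inv_coe_unit, upsilon, tw_one, Matrix.mul_apply, Fin.sum_univ_succ,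
      h.b_mul, h.c_mul, h.a_mul] <;>
    field_simp <;> ring

theorem nuRep_mul (h : IsTriangular₄ (omega p) C.b C.c a b₂) (σ τ : GQ) :
    nuRep C a b₂ (σ * τ) = nuRep C a b₂ σ * nuRep C a b₂ τ := by
  have := (omega p σ).ne_zero
  ext i j
  fin_cases i <;> fin_cases j <;>
    simp [-ZMod.inv_coe_unit, nuRep, dCochain, tw_one, Matrix.mul_apply, Fin.sum_univ_succ,
      h.b_mul, h.c_mul, h.a_mul, h.y_mul] <;>
    field_simp <;> ring

end Representations

theorem IsTriangular₃.map_one {p : ℕ} [Fact p.Prime] {G : Type*} [Group G] {w : G →* (ZMod p)ˣ}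
    {b c a : G → ZMod p} (h : IsTriangular₃ w b c a) : b 1 = 0 ∧ c 1 = 0 ∧ a 1 = 0 := by
  have hb := h.b_mul 1 1
  have hc := h.c_mul 1 1
  have ha := h.a_mul 1 1
  simp only [mul_one, _root_.map_one, Units.val_one, inv_one, one_mul] at hb hc ha
  have hb0 : b 1 = 0 := by linear_combination -hb
  rw [hb0] at ha
  exact ⟨hb0, by linear_combination -hc, by linear_combination -ha⟩

theorem IsTriangular₄.y_one {p : ℕ} [Fact p.Prime] {G : Type*} [Group G] {w : G →* (ZMod p)ˣ}
    {b c a y : G → ZMod p} (h : IsTriangular₄ w b c a y) : y 1 = 0 := by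
  have hy := h.y_mul 1 1
  obtain ⟨hb, -, -⟩ := h.toIsTriangular₃.map_one
  simp only [mul_one, map_one, Units.val_one, one_mul, hb] at hy
  linear_combination -hy

section Closed

variable {p ℓ₀ ℓ₁ : ℕ} [Fact p.Prime] {D : PinningData p ℓ₀ ℓ₁} {C : PinnedCocycles D}
  {a b₂ : GQ → ZMod p}

theorem isClosed_setOf_apply_eq (x : Qbar) : IsClosed {σ : GQ | σ x = x} :=
  Subgroup.isClosed_of_isOpen (MulAction.stabilizer GQ x) (stabilizer_isOpen_of_isIntegral x)

theorem isClosed_omega_eq_one (D : PinningData p ℓ₀ ℓ₁) : IsClosed {σ | omega p σ = 1} := by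
  simp_rw [omega_eq_one_iff D.isPrimitiveRoot]
  exact isClosed_setOf_apply_eq D.ζ

theorem isClosed_b_eq_zero (C : PinnedCocycles D) (hℓ₁ : ℓ₁.Prime) :
    IsClosed {σ | C.b σ = 0} := by
  simp_rw [C.kummer₁.eq_zero_iff D.isPrimitiveRoot (D.root₁_ne_zero hℓ₁)]
  exact isClosed_setOf_apply_eq D.root₁

theorem IsCochain.isClosed {m : ℕ} {f : GQ → ZMod p} (hf : IsCochain m f) :
    IsClosed {σ | f σ = 0} :=
  isClosed_eq hf.1 continuous_const

/-- `upsilon` as a homomorphism. -/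
noncomputable def upsilonHom (h : IsTriangular₃ (omega p) C.b C.c a) :
    GQ →* Matrix (Fin 3) (Fin 3) (ZMod p) where
  toFun := upsilon C a
  map_one' := by
    obtain ⟨hb, hc, ha⟩ := h.map_one
    ext i j
    fin_cases i <;> fin_cases j <;> simp [upsilon, tw_one, hb, hc, ha]
  map_mul' := upsilon_mul h

/-- `nuRep` as a homomorphism. -/
noncomputable def nuRepHom (h : IsTriangular₄ (omega p) C.b C.c a b₂) :
    GQ →* Matrix (Fin 4) (Fin 4) (ZMod p) where
  toFun := nuRep C a b₂
  map_one' := by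
    obtain ⟨hb, hc, ha⟩ := h.toIsTriangular₃.map_one
    ext i j
    fin_cases i <;> fin_cases j <;> simp [nuRep, dCochain, tw_one, hb, hc, ha, h.y_one]
  map_mul' := nuRep_mul h

theorem mem_ker_upsilonHom (h : IsTriangular₃ (omega p) C.b C.c a) (σ : GQ) :
    upsilonHom h σ = 1 ↔ omega p σ = 1 ∧ C.b σ = 0 ∧ C.c σ = 0 ∧ a σ = 0 := by
  obtain ⟨hb, hc, ha⟩ := h.map_one
  rw [← map_one (upsilonHom h)]
  refine (upsilon_eq_iff σ 1).trans ?_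
  rw [hb, hc, ha, map_one]

theorem mem_ker_nuRepHom (h : IsTriangular₄ (omega p) C.b C.c a b₂) (σ : GQ) :
    nuRepHom h σ = 1 ↔ omega p σ = 1 ∧ C.b σ = 0 ∧ C.c σ = 0 ∧ a σ = 0 ∧ b₂ σ = 0 := by
  obtain ⟨hb, hc, ha⟩ := h.toIsTriangular₃.map_one
  rw [← map_one (nuRepHom h)]
  refine (nuRep_eq_iff σ 1).trans ?_
  rw [hb, hc, ha, h.y_one, map_one]

theorem isClosed_ker_upsilonHom (ha : IsA1 C a) (hℓ₁ : ℓ₁.Prime) :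
    IsClosed {σ | upsilonHom (ha.isTriangular₃ hℓ₁) σ = 1} := by
  simp_rw [mem_ker_upsilonHom]
  exact (isClosed_omega_eq_one D).inter <| (isClosed_b_eq_zero C hℓ₁).inter <|
    C.c_cochain.isClosed.inter ha.cochain.isClosed

theorem isClosed_ker_nuRepHom (ha : IsA1 C a) (hb₂ : IsB2 C a b₂) (hℓ₁ : ℓ₁.Prime) :
    IsClosed {σ | nuRepHom (hb₂.isTriangular₄ ha hℓ₁) σ = 1} := by
  simp_rw [mem_ker_nuRepHom]
  exact (isClosed_omega_eq_one D).inter <| (isClosed_b_eq_zero C hℓ₁).inter <|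
    C.c_cochain.isClosed.inter <| ha.cochain.isClosed.inter hb₂.solves.1.isClosed

end Closed

/-! ### Local behaviour at $\ell_0$ and the normalizer orders -/

theorem inertiaGroup_le_decompGroup (P : Ideal Zbar) : inertiaGroup P ≤ decompGroup P := by
  have key (σ : GQ) (hσ : σ ∈ inertiaGroup P) : P ≤ σ • P := by
    intro x hx
    rw [Ideal.mem_pointwise_smul_iff_inv_smul_mem]
    have h : σ⁻¹ • x - x ∈ P := (inertiaGroup P).inv_mem hσ x
    simpa using P.add_mem h hx
  intro σ hσ
  refine le_antisymm ?_ (key σ hσ)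
  have := key σ⁻¹ ((inertiaGroup P).inv_mem hσ)
  rwa [← Ideal.pointwise_smul_le_pointwise_smul_iff (a := σ), smul_inv_smul] at this

section LocalBehaviour

variable {p ℓ₀ ℓ₁ : ℕ} [Fact p.Prime] {D : PinningData p ℓ₀ ℓ₁}

theorem PinnedCocycles.local_l0 (C : PinnedCocycles D) (hℓ₀ : ℓ₀.Prime)
    (h₀ : ℓ₀ ≡ 1 [MOD p]) (h₁ : (ℓ₁ : ZMod p) ≠ 1) (hℓ₁ : ℓ₁.Prime)
    (hpow : ∃ u : ZMod ℓ₀, u ^ p = (ℓ₁ : ZMod ℓ₀)) (σ : GQ) (hσ : σ ∈ decompGroup D.P₀) :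
    omega p σ = 1 ∧ C.b σ = 0 := by
  have := D.isPrime₀
  obtain ⟨u, hu⟩ := hpow
  refine ⟨omega_eq_one_of_mem_decompGroup D.isPrimitiveRoot hℓ₀ h₀ D.mem₀ hσ,
    C.kummer₁.eq_zero_of_mem_decompGroup D.isPrimitiveRoot hℓ₀ h₀ D.mem₀ hu.symm ?_ D.root₁_pow hσ⟩
  -- $\ell_1$ is a unit modulo $\ell_0$: otherwise $\ell_1=\ell_0\equiv1\pmod p$.
  rw [Ne, ZMod.natCast_eq_zero_iff, Nat.prime_dvd_prime_iff_eq hℓ₀ hℓ₁]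
  rintro rfl
  refine h₁ ?_
  rw [← Nat.cast_one, ZMod.natCast_eq_natCast_iff]
  exact h₀

end LocalBehaviour

theorem eq_iff_of_mul_eq_mul {k n k' n' : ℕ} (h : k * n = k' * n') (h0 : k' * n' ≠ 0) :
    n = n' ↔ k = k' := by
  constructor
  · rintro rfl
    exact Nat.eq_of_mul_eq_mul_right (Nat.pos_of_ne_zero (right_ne_zero_of_mul h0)) h
  · rintro rfl
    exact Nat.eq_of_mul_eq_mul_left (Nat.pos_of_ne_zero (left_ne_zero_of_mul h0)) h

theorem cardinality_alternative {p k n : ℕ} (hp : 2 ≤ p) (h : k * n = p ^ 4 * (p - 1))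
    (hn : n = p ^ 3 * (p - 1) ∨ n = 2 * p ^ 3) :
    (n = 2 * p ^ 3 ∨ n = p ^ 3 * (p - 1)) ∧ (n = 2 * p ^ 3 ↔ k = p * (p - 1) / 2) ∧
      (n = p ^ 3 * (p - 1) ↔ k = p) := by
  have h0 : p ^ 4 * (p - 1) ≠ 0 := mul_ne_zero (by positivity) (by omega)
  -- $e=p(p-1)/2$, so that the division in the statement is exact.
  obtain ⟨e, he⟩ := (Nat.even_mul_pred_self p).two_dvd
  have h1 : e * (2 * p ^ 3) = p ^ 4 * (p - 1) := by
    calc e * (2 * p ^ 3) = p ^ 3 * (2 * e) := by ring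
      _ = p ^ 4 * (p - 1) := by rw [← he]; ring
  have h2 : p * (p ^ 3 * (p - 1)) = p ^ 4 * (p - 1) := by ring
  refine ⟨hn.symm, ?_, eq_iff_of_mul_eq_mul (h.trans h2.symm) (h2 ▸ h0)⟩
  rw [he, Nat.mul_div_cancel_left e two_pos]
  exact eq_iff_of_mul_eq_mul (h.trans h1.symm) (h1 ▸ h0)

section DecompositionGroups

variable {p ℓ₀ ℓ₁ : ℕ} [Fact p.Prime] {D : PinningData p ℓ₀ ℓ₁} {C : PinnedCocycles D}
  {a b₂ : GQ → ZMod p} {M : IntermediateField ℚ Qbar} [Normal ℚ M]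

theorem normalizerOrder_of_fixingSubgroup_eq_ker_upsilonHom (hp : 3 ≤ p) (ha : IsA1 C a)
    (hℓ₀ : ℓ₀.Prime) (hℓ₁ : ℓ₁.Prime)
    (hloc : ∀ σ ∈ decompGroup D.P₀, omega p σ = 1 ∧ C.b σ = 0)
    (hM : M.fixingSubgroup = (upsilonHom (ha.isTriangular₃ hℓ₁)).ker)
    (P : Ideal (𝓞 M)) [P.IsPrime] (hP : (ℓ₀ : 𝓞 M) ∈ P) :
    normalizerOrder (decompSubgroup P) = p ^ 2 * (p - 1) := by
  have := D.isPrime₀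
  have hγ := inertiaGroup_le_decompGroup D.P₀ C.γ₀_mem
  obtain ⟨s, hws, hbs⟩ := C.kummer₁.exists_ne_zero hp D.isPrimitiveRoot hℓ₁ D.root₁_pow
  obtain ⟨α, hα⟩ := ha.local_l0
  rw [normalizerOrder_decompSubgroup M hℓ₀ D.P₀ D.mem₀ P hP]
  exact normalizerOrder_of_isTriangular₃
    (AlgEquiv.restrictNormalHom_surjective (K₁ := M) Qbar) (ha.isTriangular₃ hℓ₁)
    (fun σ τ ↦ (restrictNormalHom_eq_iff _ hM σ τ).trans (upsilon_eq_iff σ τ))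
    (omega_surjective D.isPrimitiveRoot) hws hbs
    (fun τ hτ ↦ ⟨(hloc τ hτ).1, (hloc τ hτ).2, hα τ hτ⟩) hγ C.c_γ₀

theorem normalizerOrder_of_fixingSubgroup_eq_ker_nuRepHom (hp : 3 ≤ p) (ha : IsA1 C a)
    (hb₂ : IsB2 C a b₂) (hℓ₀ : ℓ₀.Prime) (hℓ₁ : ℓ₁.Prime)
    (hloc : ∀ σ ∈ decompGroup D.P₀, omega p σ = 1 ∧ C.b σ = 0)
    (hM : M.fixingSubgroup = (nuRepHom (hb₂.isTriangular₄ ha hℓ₁)).ker)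
    (P : Ideal (𝓞 M)) [P.IsPrime] (hP : (ℓ₀ : 𝓞 M) ∈ P) :
    Nat.card Gal(M/ℚ) = p ^ 4 * (p - 1) ∧
      (normalizerOrder (decompSubgroup P) = p ^ 3 * (p - 1) ∨
        normalizerOrder (decompSubgroup P) = 2 * p ^ 3) := by
  have := D.isPrime₀
  have hγ := inertiaGroup_le_decompGroup D.P₀ C.γ₀_mem
  obtain ⟨s, hws, hbs⟩ := C.kummer₁.exists_ne_zero hp D.isPrimitiveRoot hℓ₁ D.root₁_pow
  obtain ⟨α, hα⟩ := ha.local_l0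
  obtain ⟨β, hβ⟩ := hb₂.local_l0
  obtain ⟨hcard, hnorm⟩ := card_of_isTriangular₄
    (AlgEquiv.restrictNormalHom_surjective (K₁ := M) Qbar) (hb₂.isTriangular₄ ha hℓ₁) (by omega)
    (fun σ τ ↦ (restrictNormalHom_eq_iff _ hM σ τ).trans (nuRep_eq_iff σ τ))
    (omega_surjective D.isPrimitiveRoot) hws hbs
    (fun τ hτ ↦ ⟨(hloc τ hτ).1, (hloc τ hτ).2, hα τ hτ, hβ τ hτ⟩) hγ C.c_γ₀
  refine ⟨hcard, ?_⟩
  rw [normalizerOrder_decompSubgroup M hℓ₀ D.P₀ D.mem₀ P hP, hnorm]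
  split_ifs
  · exact Or.inl rfl
  · exact Or.inr rfl

/-- The tuple $(1,0,0,0,1)$ occurs, so $b_2$ is nontrivial on $\mathrm{Gal}(\overline{\mathbb
Q}/M')$. Thus $M''\ne M'$ whenever $b_2$ exists. -/
theorem ker_upsilonHom_ne_ker_nuRepHom (hp : 3 ≤ p) (ha : IsA1 C a)
    (hb₂ : IsB2 C a b₂) (hℓ₁ : ℓ₁.Prime)
    (hloc : ∀ σ ∈ decompGroup D.P₀, omega p σ = 1 ∧ C.b σ = 0) :
    (upsilonHom (ha.isTriangular₃ hℓ₁)).ker ≠ (nuRepHom (hb₂.isTriangular₄ ha hℓ₁)).ker := by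
  intro heq
  have hγ := inertiaGroup_le_decompGroup D.P₀ C.γ₀_mem
  obtain ⟨s, hws, hbs⟩ := C.kummer₁.exists_ne_zero hp D.isPrimitiveRoot hℓ₁ D.root₁_pow
  obtain ⟨σ, hw, hb, hc, ha', hy⟩ := (hb₂.isTriangular₄ ha hℓ₁).exists_coordinates (by omega)
    (omega_surjective D.isPrimitiveRoot) hws hbs (hloc _ hγ).1 (hloc _ hγ).2 C.c_γ₀ 1 0 0 0 1
  have hσ : σ ∈ (upsilonHom (ha.isTriangular₃ hℓ₁)).ker :=
    (mem_ker_upsilonHom _ σ).2 ⟨hw, hb, hc, ha'⟩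
  rw [heq] at hσ
  exact one_ne_zero (hy.symm.trans ((mem_ker_nuRepHom _ σ).1 hσ).2.2.2.2)

end DecompositionGroups

theorem proposition6 (p ℓ₀ ℓ₁ : ℕ) [Fact p.Prime] (hp : 5 ≤ p)
    (hℓ₀ : ℓ₀.Prime) (hℓ₁ : ℓ₁.Prime) (h₀ : ℓ₀ ≡ 1 [MOD p])
    (h₁ : (ℓ₁ : ZMod p) ≠ 0 ∧ (ℓ₁ : ZMod p) ≠ 1 ∧ (ℓ₁ : ZMod p) ≠ -1)
    (hpow : ∃ u : ZMod ℓ₀, u ^ p = (ℓ₁ : ZMod ℓ₀))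
    (D : PinningData p ℓ₀ ℓ₁) (C : PinnedCocycles D)
    (a : GQ → ZMod p) (ha : IsA1 C a)
    (M'' : IntermediateField ℚ Qbar) (hM'' : IsFieldM'' C a M'')
    (P : Ideal (𝓞 M'')) (hP : P.IsPrime) (hPℓ₀ : (ℓ₀ : 𝓞 M'') ∈ P) :
    (M'' = fieldM' C a → normalizerOrder (decompSubgroup P) = p ^ 2 * (p - 1)) ∧
    (IntermediateField.relfinrank (fieldM' C a) M'' = p →
      (normalizerOrder (decompSubgroup P) = 2 * p ^ 3 ∨
        normalizerOrder (decompSubgroup P) = p ^ 3 * (p - 1)) ∧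
      (normalizerOrder (decompSubgroup P) = 2 * p ^ 3 ↔
        conjClassSize (decompSubgroup P) = p * (p - 1) / 2) ∧
      (normalizerOrder (decompSubgroup P) = p ^ 3 * (p - 1) ↔
        conjClassSize (decompSubgroup P) = p)) := by
  have hloc := C.local_l0 hℓ₀ h₀ h₁.2.1 hℓ₁ hpow
  have hcut3 : (fieldM' C a).fixingSubgroup = (upsilonHom (ha.isTriangular₃ hℓ₁)).ker :=
    fixingSubgroup_cutOut _ rfl (isClosed_ker_upsilonHom ha hℓ₁)
  rcases hM'' with ⟨b₂, hb₂, hM⟩ | ⟨-, hM⟩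
  · have hclosed := isClosed_ker_nuRepHom ha hb₂ hℓ₁
    have hcut4 : M''.fixingSubgroup = (nuRepHom (hb₂.isTriangular₄ ha hℓ₁)).ker :=
      hM ▸ fixingSubgroup_cutOut _ rfl hclosed
    refine ⟨fun heq ↦ ?_, fun _ ↦ ?_⟩
    · rw [heq, hcut3] at hcut4
      exact absurd hcut4 (ker_upsilonHom_ne_ker_nuRepHom (by omega) ha hb₂ hℓ₁ hloc)
    · have : Normal ℚ M'' := hM ▸ normal_cutOut _ rfl hclosed
      obtain ⟨hcard, hnorm⟩ := normalizerOrder_of_fixingSubgroup_eq_ker_nuRepHom (by omega) ha hb₂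
        hℓ₀ hℓ₁ hloc hcut4 P hPℓ₀
      exact cardinality_alternative (by omega)
        ((conjClassSize_mul_normalizerOrder (decompSubgroup P)).trans hcard) hnorm
  · refine ⟨fun _ ↦ ?_, fun h ↦ ?_⟩
    · have hnormal : Normal ℚ (fieldM' C a) := normal_cutOut _ rfl
        (isClosed_ker_upsilonHom ha hℓ₁)
      rw [← hM] at hnormal hcut3
      exact normalizerOrder_of_fixingSubgroup_eq_ker_upsilonHom (by omega) ha hℓ₀ hℓ₁ hloc
        hcut3 P hPℓ₀
    -- Without $b_2$ the degree $[M'':M']$ is $1$, not $p$.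
    · rw [hM, IntermediateField.relfinrank_self] at h
      omega
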